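/- **Setting.** For a security parameter $\kappa\in\mathbb N$ let public parameters be given: dimensions $d_1,d_2,d_3$, bit lengths $k\ge 1,\ \ell\ge 0$, LWE parameters $(n,q,\sigma)$ with $q\ge2$, $\sigma>0$, and an SIS parameter $t$, all functions of $\kappa$, such that $d_1,d_2,d_3,n,t$ and $\lceil\log_2 q\rceil$ are polynomially bounded in $\kappa$ and $t\ge 2n\log_2 q$. Let $\mathbb Z_q=\mathbb Z\cap[-q/2,q/2)$ with arithmetic modulo $q$, so $\mathbb Z_3=\{-1,0,1\}$, and let $\mathbb Q_{\langle k,\ell\rangle}=\{2^{-\ell}z : z\in\mathbb Z,\ -2^{k-1}\le z\le 2^{k-1}-1\}$. Let $\chi_\sigma$ denote the discrete Gaussian distribution on integer vectors or matrices, with probabilities proportional to $\exp(-\pi\|x\|^2/\sigma^2)$. "Polynomial-time adversary" means a (non-uniform) family of Boolean circuits of size polynomial in $\kappa$; "negligible" means smaller than every inverse polynomial in $\kappa$; two ensembles of distributions are *computationally indistinguishable* if every polynomial-time adversary accepts samples of the two with probabilities that differ by a negligible amount. **Protocol $\mathsf{Mult}$** (a client with inputs $X\in\mathbb Q_{\langle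 k,\ell\rangle}^{d_1\times d_2}$, $Y\in\mathbb Q_{\langle k,\ell\rangle}^{d_2\times d_3}$, and computing parties $P_0,P_1$). A sharing of a matrix $M$ is $[M]=([M]_0,[M]_1)=(U,\,M-U\bmod q)$ with $U$ uniform. * Setup: the client publishes uniform $A\in\mathbb Z_q^{n\times d_2}$, $B\in\mathbb Z_q^{n\times t}$. * Offline: the client samples $S\leftarrow\chi_\sigma^{n\times d_1}$, $E\leftarrow\chi_\sigma^{d_2\times d_1}$, $E'\leftarrow\chi_\sigma^{t\times d_1}$, computes $C=A^\top S+(2^\ell X)^\top+E\bmod q$ and $C'=B^\top S+E'\bmod q$, and sends $(C,C',[S]_i)$ to $P_i$. * Online: the client shares $\bar Y=2^\ell Y$ and sends $[\bar Y]_i$ to $P_i$; $P_i$ samples $[R]_i$ uniformly from $\mathbb Z_3^{t\times d_3}$, computes $[H]_i=A[\bar Y]_i+B[R]_i\bmod q$, and sends it to the other party; both form $H=[H]_0+[H]_1\bmod q$, and $P_i$ returns $[\bar Z]_i=C^\top[\bar Y]_i+C'^\top[R]_i-[S]_i^\top H\bmod q$ to the client, who outputs $Z=2^{-2\ell}([\bar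 Z]_0+[\bar Z]_1\bmod q)$. The *view* of $P_i$ consists of the messages it receives and its coins: $\mathrm{View}_i(X,Y)=(A,B,C,C',[S]_i,[\bar Y]_i,[R]_i,[H]_{1-i})$. **Assumptions.** *LWE*, with $m=d_2+t$ samples: $(A,A^\top s+e\bmod q)$ and $(A,w)$ are computationally indistinguishable, where $A\in\mathbb Z_q^{n\times m}$ and $w\in\mathbb Z_q^m$ are uniform, $s\leftarrow\chi_\sigma^n$ and $e\leftarrow\chi_\sigma^m$. *SIS*, with a norm bound $\beta=\beta(\kappa)\ge2$: every polynomial-time adversary that is given uniform $A\in\mathbb Z_q^{n\times t}$ and $h\in\mathbb Z_q^n$ finds a nonzero $r\in\mathbb Z^t$ with $\|r\|_{\max}\le\beta$ and $Ar\equiv h\pmod q$ with at most negligible probability. **Theorem.** Under the LWE and SIS assumptions, neither semi-honest, non-colluding computing party learns anything about the inputs $X,Y$ or the output $Z$ in the protocol $\mathsf{Mult}$. Precisely: for each $i\in\{0,1\}$ there is a simulator $\mathrm{Sim}_i$ (a family of polynomial-size circuits that are fed fair random coins), which gets neither $X$ nor $Y$ nor $Z$, such that for all families of inputs $X=X(\kappa)$,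 $Y=Y(\kappa)$ the view $\mathrm{View}_i(X,Y)$ is computationally indistinguishable from the output of $\mathrm{Sim}_i$. Moreover, $\mathrm{View}_i(X,Y)$ is computationally indistinguishable from a tuple of independent uniformly random matrices (over $\mathbb Z_3$ in the place of $[R]_i$ and over $\mathbb Z_q$ in all other places). -/

import Mathlib

open scoped Matrix

noncomputable section

namespace SecureMult

/-! ### Asymptotics in the security parameter -/

/-- A function of the security parameter is negligible if it decays faster than every inverse
polynomial. -/
def Negligible (f : ℕ → ℝ) : Prop :=
  Asymptotics.SuperpolynomialDecay Filter.atTop (fun κ : ℕ => (κ : ℝ)) f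

/-- `f` is bounded by a polynomial in the security parameter. -/
def PolyBounded (f : ℕ → ℕ) : Prop :=
  ∃ P : Polynomial ℕ, ∀ κ, f κ ≤ P.eval κ

/-! ### Boolean circuits

Polynomial-time adversaries are non-uniform: families of Boolean circuits of polynomial size. -/

/-- A wire of a circuit with inputs indexed by `ι`: an input, the output of the gate with the given
number, or a constant. -/
inductive Wire (ι : Type) : Type
  | input (i : ι)
  | gate (k : ℕ)
  | const (b : Bool)

/-- A Boolean circuit with inputs indexed by `ι` and outputs indexed by `o`: a list of NAND gates in
topological order, each given by its two argument wires, and a wire for each output. -/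
structure Circuit (ι o : Type) where
  gates : List (Wire ι × Wire ι)
  output : o → Wire ι

/-- The value of a wire on the input `x`, where `v` lists the values of the gates evaluated so far.
(A reference to a gate that has not been evaluated reads `false`.) -/
def Wire.value {ι : Type} (x : ι → Bool) (v : List Bool) : Wire ι → Bool
  | .input i => x i
  | .gate k => v.getD k false
  | .const b => b

/-- The values of all gates on the input `x`, in order. -/
def gateValues {ι : Type} (x : ι → Bool) (gates : List (Wire ι × Wire ι)) : List Bool :=
  gates.foldl (fun v g => v ++ [!(g.1.value x v && g.2.value x v)]) []

/-- The function computed by a circuit. -/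
def Circuit.eval {ι o : Type} (D : Circuit ι o) (x : ι → Bool) : o → Bool :=
  fun j => (D.output j).value x (gateValues x D.gates)

/-- The size of a circuit: the number of gates plus the number of outputs. -/
def Circuit.size {ι o : Type} [Fintype o] (D : Circuit ι o) : ℕ :=
  D.gates.length + Fintype.card o

/-- The probability that the circuit `D` outputs `1` on a bit string sampled from `P`. -/
def acceptProb {ι : Type} (D : Circuit ι Unit) (P : PMF (ι → Bool)) : ℝ :=
  (P.toOuterMeasure {x | D.eval x () = true}).toReal

/-- Computational indistinguishability of two ensembles of distributions on bit strings: every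
family of polynomial-size circuits has a negligible distinguishing advantage. -/
def CompIndist {ι : ℕ → Type} (P Q : ∀ κ, PMF (ι κ → Bool)) : Prop :=
  ∀ D : ∀ κ, Circuit (ι κ) Unit, PolyBounded (fun κ => (D κ).size) →
    Negligible fun κ => |acceptProb (D κ) (P κ) - acceptProb (D κ) (Q κ)|

/-- The output distribution of a circuit that is fed `c` independent fair coins. -/
def samplerDist {o : Type} {c : ℕ} (G : Circuit (Fin c) o) : PMF (o → Bool) :=
  (PMF.uniformOfFintype (Fin c → Bool)).map G.eval

/-! ### Binary encodings of vectors and matrices over `ℤ/q` -/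

/-- Bit positions of a matrix over `ZMod q`; an entry takes `⌈log₂ q⌉` bits. -/
abbrev MatBits (a b q : ℕ) : Type := Fin a × Fin b × Fin (Nat.clog 2 q)

/-- Bit positions of a vector over `ZMod q`. -/
abbrev VecBits (a q : ℕ) : Type := Fin a × Fin (Nat.clog 2 q)

/-- Binary encoding of a matrix, entry by entry. -/
def encMat {a b q : ℕ} (M : Matrix (Fin a) (Fin b) (ZMod q)) : MatBits a b q → Bool :=
  fun z => (M z.1 z.2.1).val.testBit z.2.2

/-- Binary encoding of a vector, entry by entry. -/
def encVec {a q : ℕ} (v : Fin a → ZMod q) : VecBits a q → Bool :=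
  fun z => (v z.1).val.testBit z.2

/-- The representative in `[-q/2, q/2)` of a residue class modulo `q`. -/
def centered {q : ℕ} (x : ZMod q) : ℤ := Int.bmod x.val q

/-! ### Discrete Gaussian distributions -/

/-- The Gaussian weight `exp (-π ‖x‖² / σ²)` (Euclidean norm). -/
def gaussWeight {ι : Type} [Fintype ι] (σ : ℝ) (x : ι → ℤ) : ℝ :=
  Real.exp (-Real.pi * (∑ i, (x i : ℝ) ^ 2) / σ ^ 2)

theorem summable_gauss_int {σ : ℝ} (hσ : 0 < σ) :
    Summable fun z : ℤ => Real.exp (-Real.pi * (z : ℝ) ^ 2 / σ ^ 2) := by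
  have hc : -(Real.pi / σ ^ 2) < 0 := by
    have : 0 < Real.pi / σ ^ 2 := by positivity
    linarith
  have h := Real.summable_exp_nat_mul_of_ge hc (f := fun i : ℕ => (i : ℝ) ^ 2) (fun i => by
    have : i ≤ i ^ 2 := Nat.le_self_pow (by norm_num) i
    exact_mod_cast this)
  refine Summable.of_nat_of_neg (h.congr fun i => ?_) (h.congr fun i => ?_) <;>
  · congr 1
    push_cast
    ring

theorem gaussWeight_eq_prod {ι : Type} [Fintype ι] (σ : ℝ) (x : ι → ℤ) :
    gaussWeight σ x = ∏ i, Real.exp (-Real.pi * (x i : ℝ) ^ 2 / σ ^ 2) := by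
  rw [gaussWeight, ← Real.exp_sum, Finset.mul_sum, Finset.sum_div]

theorem summable_gaussWeight {ι : Type} [Fintype ι] {σ : ℝ} (hσ : 0 < σ) :
    Summable fun x : ι → ℤ => gaussWeight σ x := by
  classical
  set g : ℤ → ℝ := fun z => Real.exp (-Real.pi * (z : ℝ) ^ 2 / σ ^ 2) with hg
  have hs : Summable g := summable_gauss_int hσ
  refine summable_of_sum_le (c := ∏ _i : ι, ∑' z, g z) (fun x => (Real.exp_pos _).le) fun u => ?_
  calc ∑ x ∈ u, gaussWeight σ x
      ≤ ∑ x ∈ Fintype.piFinset (fun i => u.image fun x => x i), gaussWeight σ x := by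
        refine Finset.sum_le_sum_of_subset_of_nonneg (fun x hx => ?_)
          fun x _ _ => (Real.exp_pos _).le
        exact Fintype.mem_piFinset.2 fun i => Finset.mem_image_of_mem _ hx
    _ = ∏ i, ∑ z ∈ u.image (fun x => x i), g z := by
        rw [Finset.prod_univ_sum]
        exact Finset.sum_congr rfl fun x _ => gaussWeight_eq_prod σ x
    _ ≤ ∏ _i : ι, ∑' z, g z :=
        Finset.prod_le_prod (fun i _ => Finset.sum_nonneg fun z _ => (Real.exp_pos _).le)
          fun i _ => hs.sum_le_tsum _ fun z _ => (Real.exp_pos _).le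

theorem tsum_gaussWeight_ne_zero {ι : Type} [Fintype ι] (σ : ℝ) :
    ∑' x : ι → ℤ, ENNReal.ofReal (gaussWeight σ x) ≠ 0 := by
  intro h
  have := ENNReal.tsum_eq_zero.1 h 0
  rw [ENNReal.ofReal_eq_zero] at this
  exact absurd this (not_le.2 (Real.exp_pos _))

theorem tsum_gaussWeight_ne_top {ι : Type} [Fintype ι] {σ : ℝ} (hσ : 0 < σ) :
    ∑' x : ι → ℤ, ENNReal.ofReal (gaussWeight σ x) ≠ ⊤ := by
  rw [← ENNReal.ofReal_tsum_of_nonneg (f := fun x : ι → ℤ => gaussWeight σ x)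
    (fun x => (Real.exp_pos _).le) (summable_gaussWeight hσ)]
  exact ENNReal.ofReal_ne_top

/-- The discrete Gaussian distribution of width `σ` over `ℤ^ι`:
`Pr[x] = exp (-π ‖x‖² / σ²) / ∑ y, exp (-π ‖y‖² / σ²)`. -/
def discreteGaussian (ι : Type) [Fintype ι] (σ : ℝ) (hσ : 0 < σ) : PMF (ι → ℤ) :=
  PMF.normalize (fun x => ENNReal.ofReal (gaussWeight σ x))
    (tsum_gaussWeight_ne_zero σ) (tsum_gaussWeight_ne_top hσ)

/-- An `a × b` integer matrix with discrete Gaussian distribution, reduced modulo `q`. -/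
def gaussMatrix (a b q : ℕ) (σ : ℝ) (hσ : 0 < σ) : PMF (Matrix (Fin a) (Fin b) (ZMod q)) :=
  (discreteGaussian (Fin a × Fin b) σ hσ).map fun x => Matrix.of fun i j => (x (i, j) : ZMod q)

/-- A uniformly random `a × b` matrix over `ZMod q`. -/
def uniformMatrix (a b q : ℕ) [NeZero q] : PMF (Matrix (Fin a) (Fin b) (ZMod q)) :=
  PMF.uniformOfFintype _

/-- A uniformly random vector over `ZMod q`. -/
def uniformVec (a q : ℕ) [NeZero q] : PMF (Fin a → ZMod q) :=
  PMF.uniformOfFintype _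

/-! ### The public parameters -/

/-- Public parameters of the protocol: matrix dimensions `d₁, d₂, d₃`, bit lengths `k, l` of the
fixed-point numbers, LWE parameters `n, q, σ` and SIS parameter `t`. -/
structure Params where
  d₁ : ℕ
  d₂ : ℕ
  d₃ : ℕ
  k : ℕ
  l : ℕ
  n : ℕ
  q : ℕ
  σ : ℝ
  t : ℕ
  k_pos : 0 < k
  two_le_q : 2 ≤ q
  σ_pos : 0 < σ

instance (p : Params) : NeZero p.q := ⟨by have := p.two_le_q; omega⟩

/-- All dimensions and the bit length of the modulus are polynomial in the security parameter. -/
structure PolyParams (p : ℕ → Params) : Prop where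
  d₁ : PolyBounded fun κ => (p κ).d₁
  d₂ : PolyBounded fun κ => (p κ).d₂
  d₃ : PolyBounded fun κ => (p κ).d₃
  n : PolyBounded fun κ => (p κ).n
  log_q : PolyBounded fun κ => Nat.clog 2 (p κ).q
  t : PolyBounded fun κ => (p κ).t

/-! ### Learning with errors -/

/-- Bit positions of an LWE instance with `m` samples. -/
abbrev LWEBits (n m q : ℕ) : Type := MatBits n m q ⊕ VecBits m q

/-- The LWE distribution `(A, Aᵀ s + e mod q)`, encoded. -/
def lweReal (n m q : ℕ) [NeZero q] (σ : ℝ) (hσ : 0 < σ) : PMF (LWEBits n m q → Bool) := do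
  let A ← uniformMatrix n m q
  let s ← discreteGaussian (Fin n) σ hσ
  let e ← discreteGaussian (Fin m) σ hσ
  let b : Fin m → ZMod q := Aᵀ *ᵥ (fun i => (s i : ZMod q)) + fun j => (e j : ZMod q)
  return Sum.elim (encMat A) (encVec b)

/-- The uniform distribution `(A, w)`, encoded. -/
def lweUniform (n m q : ℕ) [NeZero q] : PMF (LWEBits n m q → Bool) := do
  let A ← uniformMatrix n m q
  let w ← uniformVec m q
  return Sum.elim (encMat A) (encVec w)

/-- The decision-LWE assumption for the LWE parameters of `p` and `m` samples. -/
def LWEAssumption (p : ℕ → Params) (m : ℕ → ℕ) : Prop :=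
  CompIndist (fun κ => lweReal (p κ).n (m κ) (p κ).q (p κ).σ (p κ).σ_pos)
    (fun κ => lweUniform (p κ).n (m κ) (p κ).q)

/-! ### Short integer solution -/

/-- Bit positions of an SIS instance. -/
abbrev SISBits (n t q : ℕ) : Type := MatBits n t q ⊕ VecBits n q

/-- The integer encoded by a sign bit followed by the binary digits of the absolute value, least
significant digit first. -/
def decodeInt {w : ℕ} (b : Fin (w + 1) → Bool) : ℤ :=
  (if b 0 then -1 else 1) * ∑ j : Fin w, if b j.succ then 2 ^ (j : ℕ) else 0

/-- `r` is a nonzero integer vector of max-norm at most `β` with `A r = h mod q`. -/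
def IsSISSolution {n t q : ℕ} (β : ℝ) (A : Matrix (Fin n) (Fin t) (ZMod q)) (h : Fin n → ZMod q)
    (r : Fin t → ℤ) : Prop :=
  r ≠ 0 ∧ (∀ i, |(r i : ℝ)| ≤ β) ∧ h = A *ᵥ fun i => (r i : ZMod q)

/-- A uniformly random SIS instance `(A, h)`. -/
def sisInstance (n t q : ℕ) [NeZero q] :
    PMF (Matrix (Fin n) (Fin t) (ZMod q) × (Fin n → ZMod q)) := do
  let A ← uniformMatrix n t q
  let h ← uniformVec n q
  return (A, h)

/-- The probability that a circuit, on a random SIS instance, outputs a solution. The circuit writes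
each coordinate of its answer with a sign bit and `w` digits. -/
def sisSuccess {n t q w : ℕ} [NeZero q] (β : ℝ)
    (D : Circuit (SISBits n t q) (Fin t × Fin (w + 1))) : ℝ :=
  ((sisInstance n t q).toOuterMeasure {z | IsSISSolution β z.1 z.2
    fun i => decodeInt fun b => D.eval (Sum.elim (encMat z.1) (encVec z.2)) (i, b)}).toReal

/-- The (inhomogeneous) SIS assumption for the dimension `n`, the modulus `q` and the SIS parameter
`t` of `p` and for the max-norm bound `β`. -/
def SISAssumption (p : ℕ → Params) (β : ℕ → ℝ) : Prop :=
  ∀ (w : ℕ → ℕ)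
    (D : ∀ κ, Circuit (SISBits (p κ).n (p κ).t (p κ).q) (Fin (p κ).t × Fin (w κ + 1))),
    PolyBounded (fun κ => (D κ).size) → Negligible fun κ => sisSuccess (β κ) (D κ)

/-! ### The protocol -/

/-- The `k`-bit fixed-point numbers with `l` fractional bits: `2⁻ˡ z`, where
`-2^(k-1) ≤ z ≤ 2^(k-1) - 1`. -/
def fixedPoint (k l : ℕ) : Set ℝ :=
  {x | ∃ z : ℤ, -2 ^ (k - 1) ≤ z ∧ z ≤ 2 ^ (k - 1) - 1 ∧ x = z / 2 ^ l}

/-- The encoding `2ˡ X` of a fixed-point matrix (the floor returns the integer `2ˡ x`), regarded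
modulo `q`. -/
def encodeFixed {a b k : ℕ} (l q : ℕ) (X : Matrix (Fin a) (Fin b) (fixedPoint k l)) :
    Matrix (Fin a) (Fin b) (ZMod q) :=
  Matrix.of fun i j => ((⌊(2 : ℝ) ^ l * (X i j : ℝ)⌋ : ℤ) : ZMod q)

/-- Additive secret sharing: `(R, M - R mod q)` for a uniformly random `R`. -/
def share {a b q : ℕ} [NeZero q] (M : Matrix (Fin a) (Fin b) (ZMod q)) :
    PMF (Fin 2 → Matrix (Fin a) (Fin b) (ZMod q)) := do
  let R ← uniformMatrix a b q
  return ![R, M - R]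

/-- Reconstruction of a secret from its two shares. -/
def reconst {a b q : ℕ} (M : Fin 2 → Matrix (Fin a) (Fin b) (ZMod q)) :
    Matrix (Fin a) (Fin b) (ZMod q) :=
  M 0 + M 1

/-- A matrix with entries in `{-1, 0, 1}` (representatives of the residues modulo `3`), regarded
modulo `q`. -/
def ternary {a b : ℕ} (q : ℕ) (R : Matrix (Fin a) (Fin b) (ZMod 3)) :
    Matrix (Fin a) (Fin b) (ZMod q) :=
  R.map fun r => (centered r : ZMod q)

/-- Everything that is computed in an execution of the protocol and is sent to, sampled by or
computed by one of the parties, with the client's result `Z`. A function on `Fin 2` gives the share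
of each of the parties `P₀`, `P₁`. -/
structure Execution (p : Params) where
  A : Matrix (Fin p.n) (Fin p.d₂) (ZMod p.q)
  B : Matrix (Fin p.n) (Fin p.t) (ZMod p.q)
  C : Matrix (Fin p.d₂) (Fin p.d₁) (ZMod p.q)
  C' : Matrix (Fin p.t) (Fin p.d₁) (ZMod p.q)
  S : Fin 2 → Matrix (Fin p.n) (Fin p.d₁) (ZMod p.q)
  Y : Fin 2 → Matrix (Fin p.d₂) (Fin p.d₃) (ZMod p.q)
  R : Fin 2 → Matrix (Fin p.t) (Fin p.d₃) (ZMod 3)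
  H : Fin 2 → Matrix (Fin p.n) (Fin p.d₃) (ZMod p.q)
  Zbar : Fin 2 → Matrix (Fin p.d₁) (Fin p.d₃) (ZMod p.q)
  Z : Matrix (Fin p.d₁) (Fin p.d₃) ℝ

/-- `Mult.Setup`: the common reference string `(A, B)`. -/
def setup (p : Params) : PMF
    (Matrix (Fin p.n) (Fin p.d₂) (ZMod p.q) × Matrix (Fin p.n) (Fin p.t) (ZMod p.q)) := do
  let A ← uniformMatrix p.n p.d₂ p.q
  let B ← uniformMatrix p.n p.t p.q
  return (A, B)

/-- `Mult.Offline`: the LWE ciphertexts `C`, `C'` and the shares of `S`. -/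
def offline (p : Params) (A : Matrix (Fin p.n) (Fin p.d₂) (ZMod p.q))
    (B : Matrix (Fin p.n) (Fin p.t) (ZMod p.q))
    (X : Matrix (Fin p.d₁) (Fin p.d₂) (fixedPoint p.k p.l)) : PMF
    (Matrix (Fin p.d₂) (Fin p.d₁) (ZMod p.q) × Matrix (Fin p.t) (Fin p.d₁) (ZMod p.q) ×
      (Fin 2 → Matrix (Fin p.n) (Fin p.d₁) (ZMod p.q))) := do
  let Xbar := encodeFixed p.l p.q X
  let S ← gaussMatrix p.n p.d₁ p.q p.σ p.σ_pos
  let E ← gaussMatrix p.d₂ p.d₁ p.q p.σ p.σ_pos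
  let E' ← gaussMatrix p.t p.d₁ p.q p.σ p.σ_pos
  let S' ← share S
  return (Aᵀ * S + Xbarᵀ + E, Bᵀ * S + E', S')

/-- `Mult.Online`: the client shares `Y`, each party samples its share of `R`, the parties open the
shares of `H`, and each party returns its share of the product to the client. -/
def online (p : Params) (A : Matrix (Fin p.n) (Fin p.d₂) (ZMod p.q))
    (B : Matrix (Fin p.n) (Fin p.t) (ZMod p.q)) (C : Matrix (Fin p.d₂) (Fin p.d₁) (ZMod p.q))
    (C' : Matrix (Fin p.t) (Fin p.d₁) (ZMod p.q))
    (S : Fin 2 → Matrix (Fin p.n) (Fin p.d₁) (ZMod p.q))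
    (Y : Matrix (Fin p.d₂) (Fin p.d₃) (fixedPoint p.k p.l)) : PMF (Execution p) := do
  let Ysh ← share (encodeFixed p.l p.q Y)
  let R₀ ← uniformMatrix p.t p.d₃ 3
  let R₁ ← uniformMatrix p.t p.d₃ 3
  let R : Fin 2 → Matrix (Fin p.t) (Fin p.d₃) (ZMod 3) := ![R₀, R₁]
  let H : Fin 2 → Matrix (Fin p.n) (Fin p.d₃) (ZMod p.q) :=
    fun i => A * Ysh i + B * ternary p.q (R i)
  let Zbar : Fin 2 → Matrix (Fin p.d₁) (Fin p.d₃) (ZMod p.q) :=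
    fun i => Cᵀ * Ysh i + C'ᵀ * ternary p.q (R i) - (S i)ᵀ * reconst H
  return {
    A := A, B := B, C := C, C' := C', S := S, Y := Ysh, R := R, H := H, Zbar := Zbar
    Z := (reconst Zbar).map fun z => (centered z : ℝ) / 2 ^ (2 * p.l) }

/-- The protocol `Mult` on the client's inputs `X` and `Y`. -/
def mult (p : Params) (X : Matrix (Fin p.d₁) (Fin p.d₂) (fixedPoint p.k p.l))
    (Y : Matrix (Fin p.d₂) (Fin p.d₃) (fixedPoint p.k p.l)) : PMF (Execution p) := do
  let crs ← setup p
  let off ← offline p crs.1 crs.2 X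
  online p crs.1 crs.2 off.1 off.2.1 off.2.2 Y

/-! ### Views -/

/-- The view of a computing party: the messages `A, B`, `C, C'` and the shares of `S` and `Y`
received from the client, the random coins `R` of the party, and the share of `H` received from the
other party. (The parties have no private input; everything else they compute, including their
share of the product, is a function of the view.) -/
structure View (p : Params) where
  A : Matrix (Fin p.n) (Fin p.d₂) (ZMod p.q)
  B : Matrix (Fin p.n) (Fin p.t) (ZMod p.q)
  C : Matrix (Fin p.d₂) (Fin p.d₁) (ZMod p.q)
  C' : Matrix (Fin p.t) (Fin p.d₁) (ZMod p.q)
  S : Matrix (Fin p.n) (Fin p.d₁) (ZMod p.q)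
  Y : Matrix (Fin p.d₂) (Fin p.d₃) (ZMod p.q)
  R : Matrix (Fin p.t) (Fin p.d₃) (ZMod 3)
  H : Matrix (Fin p.n) (Fin p.d₃) (ZMod p.q)

/-- The view of party `Pᵢ` in an execution; the other party is `P_{1-i}`. -/
def Execution.view {p : Params} (i : Fin 2) (e : Execution p) : View p where
  A := e.A
  B := e.B
  C := e.C
  C' := e.C'
  S := e.S i
  Y := e.Y i
  R := e.R i
  H := e.H (1 - i)

/-- Bit positions of a view. -/
abbrev ViewBits (p : Params) : Type :=
  MatBits p.n p.d₂ p.q ⊕ MatBits p.n p.t p.q ⊕ MatBits p.d₂ p.d₁ p.q ⊕ MatBits p.t p.d₁ p.q ⊕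
    MatBits p.n p.d₁ p.q ⊕ MatBits p.d₂ p.d₃ p.q ⊕ MatBits p.t p.d₃ 3 ⊕ MatBits p.n p.d₃ p.q

/-- Binary encoding of a view. -/
def View.encode {p : Params} (v : View p) : ViewBits p → Bool :=
  Sum.elim (encMat v.A) <| Sum.elim (encMat v.B) <| Sum.elim (encMat v.C) <|
    Sum.elim (encMat v.C') <| Sum.elim (encMat v.S) <| Sum.elim (encMat v.Y) <|
      Sum.elim (encMat v.R) (encMat v.H)

/-- The distribution of the (encoded) view of party `Pᵢ` in the protocol on the inputs `X`, `Y`. -/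
def viewDist (i : Fin 2) (p : Params) (X : Matrix (Fin p.d₁) (Fin p.d₂) (fixedPoint p.k p.l))
    (Y : Matrix (Fin p.d₂) (Fin p.d₃) (fixedPoint p.k p.l)) : PMF (ViewBits p → Bool) :=
  (mult p X Y).map fun e => (e.view i).encode

/-- The distribution of an (encoded) view whose entries are all uniform and independent. -/
def uniformView (p : Params) : PMF (ViewBits p → Bool) := do
  let A ← uniformMatrix p.n p.d₂ p.q
  let B ← uniformMatrix p.n p.t p.q
  let C ← uniformMatrix p.d₂ p.d₁ p.q
  let C' ← uniformMatrix p.t p.d₁ p.q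
  let S ← uniformMatrix p.n p.d₁ p.q
  let Y ← uniformMatrix p.d₂ p.d₃ p.q
  let R ← uniformMatrix p.t p.d₃ 3
  let H ← uniformMatrix p.n p.d₃ p.q
  return View.encode { A := A, B := B, C := C, C' := C', S := S, Y := Y, R := R, H := H }

end SecureMult

end

/-!
Given `B`, the leftover hash lemma makes the other party's summand `B R` of `H` uniform. Two ternary
vectors whose difference has an entry `±1`, which is invertible modulo every `q`, collide under a
uniform `B` with probability exactly `q⁻ⁿ`, and only a fraction `(5/9)ᵗ` of the pairs has no such
entry; since `2ᵗ ≥ q²ⁿ`, the fourth power of the distance to uniform is at most `q⁻ⁿ`. The SIS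
assumption makes `q⁻ⁿ` negligible, because the constant answer `(1, 0, …, 0)` solves a random
instance with probability at least `q⁻ⁿ`. Once the share of `H` is uniform, the secret `S` is only
used in `C` and `C'`, whose columns are LWE samples for the matrix `(A | B)`; a hybrid argument over
the `d₁` columns replaces them by uniform vectors, and the shift by `Xᵀ` disappears. Every step of
the reduction is affine in each entry modulo `q`, which bounds the circuits, and the uniform view
can be sampled from fair coins up to an error `2 ^ (-κ)` per encoded bit.
-/

noncomputable section

namespace SecureMult

/-! ### Asymptotics -/

theorem PolyBounded.mono {f g : ℕ → ℕ} (hg : PolyBounded g) (h : ∀ κ, f κ ≤ g κ) :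
    PolyBounded f :=
  let ⟨P, hP⟩ := hg
  ⟨P, fun κ => (h κ).trans (hP κ)⟩

theorem PolyBounded.add {f g : ℕ → ℕ} (hf : PolyBounded f) (hg : PolyBounded g) :
    PolyBounded fun κ => f κ + g κ :=
  let ⟨P, hP⟩ := hf
  let ⟨Q, hQ⟩ := hg
  ⟨P + Q, fun κ => by rw [Polynomial.eval_add]; exact add_le_add (hP κ) (hQ κ)⟩

theorem PolyBounded.mul {f g : ℕ → ℕ} (hf : PolyBounded f) (hg : PolyBounded g) :
    PolyBounded fun κ => f κ * g κ :=
  let ⟨P, hP⟩ := hf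
  let ⟨Q, hQ⟩ := hg
  ⟨P * Q, fun κ => by rw [Polynomial.eval_mul]; exact Nat.mul_le_mul (hP κ) (hQ κ)⟩

theorem PolyBounded.const (c : ℕ) : PolyBounded fun _ => c :=
  ⟨Polynomial.C c, fun κ => by simp⟩

theorem PolyBounded.id : PolyBounded fun κ => κ :=
  ⟨Polynomial.X, fun κ => by simp⟩

theorem Negligible.mono {f g : ℕ → ℝ} (hg : Negligible g) (h : ∀ κ, |f κ| ≤ g κ) :
    Negligible f :=
  Asymptotics.SuperpolynomialDecay.trans_abs_le hg fun κ => (h κ).trans (le_abs_self _)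

theorem Negligible.add {f g : ℕ → ℝ} (hf : Negligible f) (hg : Negligible g) :
    Negligible fun κ => f κ + g κ :=
  Asymptotics.SuperpolynomialDecay.add hf hg

theorem Negligible.polyBounded_mul {f : ℕ → ℝ} {d : ℕ → ℕ} (hf : Negligible f)
    (hd : PolyBounded d) : Negligible fun κ => (d κ : ℝ) * f κ := by
  obtain ⟨P, hP⟩ := hd
  have eval_cast (κ : ℕ) :
      Polynomial.eval (κ : ℝ) (P.map (Nat.castRingHom ℝ)) = ((P.eval κ : ℕ) : ℝ) := by
    simp [Polynomial.eval_map, Polynomial.eval₂_at_natCast]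
  have h := Asymptotics.SuperpolynomialDecay.polynomial_mul hf (P.map (Nat.castRingHom ℝ))
  refine h.trans_abs_le fun κ => ?_
  simp only [abs_mul, eval_cast, Nat.abs_cast]
  gcongr
  exact hP κ

theorem Negligible.sqrt {f : ℕ → ℝ} (hf : Negligible f) : Negligible fun κ => √(f κ) := by
  intro n
  have h := (hf (n * 2)).sqrt
  simp only [Real.sqrt_zero] at h
  refine h.congr fun κ => ?_
  rw [pow_mul, Real.sqrt_mul (by positivity), Real.sqrt_sq (by positivity)]

theorem negligible_inv_two_pow : Negligible fun κ => ((2 : ℝ) ^ κ)⁻¹ := by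
  intro n
  have h := tendsto_pow_const_div_const_pow_of_one_lt n (one_lt_two : (1 : ℝ) < 2)
  simpa only [div_eq_mul_inv] using h

theorem CompIndist.trans {ι : ℕ → Type} {P Q R : ∀ κ, PMF (ι κ → Bool)} (h : CompIndist P Q)
    (h' : CompIndist Q R) : CompIndist P R := fun D hD =>
  ((h D hD).add (h' D hD)).mono fun κ => by
    rw [abs_abs]
    exact abs_sub_le _ _ _

/-! ### Probabilities and distinguishing advantages -/

section Advantage

variable {α β : Type*}

/-- The probability of the event `s`, as a real number. -/
def prob (s : Set β) (P : PMF β) : ℝ := (P.toOuterMeasure s).toReal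

theorem toOuterMeasure_le_one (s : Set β) (P : PMF β) : P.toOuterMeasure s ≤ 1 := by
  rw [PMF.toOuterMeasure_apply, ← P.tsum_coe]
  exact ENNReal.tsum_le_tsum fun _ => Set.indicator_le_self _ _ _

theorem prob_nonneg (s : Set β) (P : PMF β) : 0 ≤ prob s P := ENNReal.toReal_nonneg

theorem prob_le_one (s : Set β) (P : PMF β) : prob s P ≤ 1 :=
  ENNReal.toReal_le_of_le_ofReal zero_le_one (by simpa using toOuterMeasure_le_one s P)

theorem prob_map (s : Set β) (P : PMF α) (f : α → β) : prob s (P.map f) = prob (f ⁻¹' s) P := by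
  rw [prob, prob, PMF.toOuterMeasure_map_apply]

/-- The advantage of the test `s` at telling `P` from `Q`: the difference of the probabilities of
the event `s`. -/
def adv (s : Set β) (P Q : PMF β) : ℝ := |prob s P - prob s Q|

theorem adv_self (s : Set β) (P : PMF β) : adv s P P = 0 := by simp [adv]

theorem adv_comm (s : Set β) (P Q : PMF β) : adv s P Q = adv s Q P := abs_sub_comm _ _

theorem adv_triangle (s : Set β) (P Q R : PMF β) : adv s P R ≤ adv s P Q + adv s Q R :=
  abs_sub_le _ _ _

theorem sum_toReal [Fintype α] (P : PMF α) : ∑ a, (P a).toReal = 1 := by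
  rw [← ENNReal.toReal_sum fun a _ => P.apply_ne_top a, ← tsum_fintype (L := .unconditional _),
    P.tsum_coe, ENNReal.toReal_one]

theorem prob_bind [Fintype α] (s : Set β) (P : PMF α) (f : α → PMF β) :
    prob s (P.bind f) = ∑ a, (P a).toReal * prob s (f a) := by
  rw [prob, PMF.toOuterMeasure_bind_apply, tsum_fintype, ENNReal.toReal_sum fun a _ =>
    ENNReal.mul_ne_top (P.apply_ne_top a)
      ((toOuterMeasure_le_one s (f a)).trans_lt ENNReal.one_lt_top).ne]
  simp only [ENNReal.toReal_mul, prob]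

theorem adv_bind_le_sum [Fintype α] (s : Set β) (P : PMF α) (f g : α → PMF β) :
    adv s (P.bind f) (P.bind g) ≤ ∑ a, (P a).toReal * adv s (f a) (g a) := by
  rw [adv, prob_bind, prob_bind, ← Finset.sum_sub_distrib]
  refine (Finset.abs_sum_le_sum_abs _ _).trans_eq (Finset.sum_congr rfl fun a _ => ?_)
  rw [← mul_sub, abs_mul, abs_of_nonneg ENNReal.toReal_nonneg, adv]

theorem adv_bind_le [Finite α] {s : Set β} (P : PMF α) {f g : α → PMF β} {ε : ℝ}
    (h : ∀ a, adv s (f a) (g a) ≤ ε) : adv s (P.bind f) (P.bind g) ≤ ε :=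
  have := Fintype.ofFinite α
  calc adv s (P.bind f) (P.bind g)
      ≤ ∑ a, (P a).toReal * adv s (f a) (g a) := adv_bind_le_sum s P f g
    _ ≤ ∑ a, (P a).toReal * ε := by gcongr with a; exact h a
    _ = ε := by rw [← Finset.sum_mul, sum_toReal, one_mul]

theorem exists_adv_bind_le [Finite α] (s : Set β) (P : PMF α) (f g : α → PMF β) :
    ∃ a, adv s (P.bind f) (P.bind g) ≤ adv s (f a) (g a) := by
  have : Nonempty α := P.support_nonempty.to_type
  obtain ⟨a, ha⟩ := Finite.exists_max fun a => adv s (f a) (g a)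
  exact ⟨a, adv_bind_le P ha⟩

/-- The statistical (total variation) distance of two distributions on a finite type. -/
def tvDist [Fintype α] (P Q : PMF α) : ℝ := (∑ a, |(P a).toReal - (Q a).toReal|) / 2

theorem adv_bind_le_tvDist [Fintype α] (s : Set β) (P Q : PMF α) (f : α → PMF β) :
    adv s (P.bind f) (Q.bind f) ≤ tvDist P Q := by
  -- As `P` and `Q` have the same mass, `prob s (f a)` may be replaced by its deviation from `1/2`.
  have shift : prob s (P.bind f) - prob s (Q.bind f) =
      ∑ a, ((P a).toReal - (Q a).toReal) * (prob s (f a) - 1 / 2) := by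
    simp only [mul_sub, sub_mul, Finset.sum_sub_distrib, ← Finset.sum_mul, sum_toReal, prob_bind]
    ring
  rw [adv, shift, tvDist, Finset.sum_div]
  refine (Finset.abs_sum_le_sum_abs _ _).trans (Finset.sum_le_sum fun a _ => ?_)
  have deviation : |prob s (f a) - 1 / 2| ≤ 1 / 2 := by
    rw [abs_le]
    constructor <;> linarith [prob_nonneg s (f a), prob_le_one s (f a)]
  rw [abs_mul, div_eq_mul_one_div |_|]
  exact mul_le_mul_of_nonneg_left deviation (abs_nonneg _)

end Advantage

/-! ### Independent samples and the hybrid argument -/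

section Independent

variable {ι α α' β γ : Type*}

theorem pmf_bind_congr {P : PMF α} {f g : α → PMF β} (h : ∀ a, f a = g a) :
    P.bind f = P.bind g :=
  congrArg P.bind (funext h)

theorem bind_equiv {P : PMF α} {Q : PMF α'} (e : α ≃ α') (h : ∀ a, P a = Q (e a))
    (f : α' → PMF β) : P.bind (fun a => f (e a)) = Q.bind f := by
  ext b
  rw [PMF.bind_apply, PMF.bind_apply, ← e.tsum_eq]
  simp only [h]

theorem uniform_bind_equiv [Fintype α] [Nonempty α] [Fintype α'] [Nonempty α'] (e : α ≃ α')
    (f : α' → PMF β) :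
    (PMF.uniformOfFintype α).bind (fun a => f (e a)) = (PMF.uniformOfFintype α').bind f :=
  bind_equiv e (by simp [Fintype.card_congr e]) f

/-- The distribution of a pair of independent samples of `P` and `Q`. -/
def prodPMF (P : PMF α) (Q : PMF β) : PMF (α × β) := P.bind fun a => Q.map fun b => (a, b)

theorem prodPMF_bind (P : PMF α) (Q : PMF β) (f : α × β → PMF γ) :
    (prodPMF P Q).bind f = P.bind fun a => Q.bind fun b => f (a, b) := by
  simp only [prodPMF, PMF.bind_bind, PMF.bind_map, Function.comp_def]

theorem prodPMF_apply (P : PMF α) (Q : PMF β) (x : α × β) : prodPMF P Q x = P x.1 * Q x.2 := by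
  classical
  obtain ⟨a, b⟩ := x
  rw [prodPMF, PMF.bind_apply, tsum_eq_single a, PMF.map_apply, tsum_eq_single b, if_pos rfl]
  · intro b' hb
    simp [hb.symm]
  · intro a' ha
    simp [PMF.map_apply, ha.symm]

theorem prodPMF_uniform [Fintype α] [Nonempty α] [Fintype β] [Nonempty β] :
    prodPMF (PMF.uniformOfFintype α) (PMF.uniformOfFintype β) = PMF.uniformOfFintype (α × β) := by
  ext x
  simp [prodPMF_apply, ENNReal.mul_inv]

variable [Fintype ι] [DecidableEq ι] [Fintype α]

/-- The distribution of a family of independent samples, the `i`-th one of `μ i`. -/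
def piPMF (μ : ι → PMF α) : PMF (ι → α) :=
  PMF.ofFintype (fun x => ∏ i, μ i (x i)) (by
    have h (i : ι) : ∑ a, μ i a = 1 := by
      rw [← tsum_fintype (L := .unconditional _), (μ i).tsum_coe]
    rw [← Fintype.piFinset_univ, ← Finset.prod_univ_sum]
    simp [h])

theorem piPMF_apply (μ : ι → PMF α) (x : ι → α) : piPMF μ x = ∏ i, μ i (x i) := rfl

theorem piPMF_bind_update {μ ν : ι → PMF α} {j : ι} (h : ∀ i ≠ j, μ i = ν i)
    (f : (ι → α) → PMF β) :
    (piPMF μ).bind f = (piPMF ν).bind fun u => (μ j).bind fun a => f (Function.update u j a) := by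
  let rest : PMF ({i // i ≠ j} → α) := piPMF fun i => ν i
  let e := (Equiv.funSplitAt j α).symm
  have split {μ : ι → PMF α} (h : ∀ i ≠ j, μ i = ν i) (x : α × ({i // i ≠ j} → α)) :
      prodPMF (μ j) rest x = piPMF μ (e x) := by
    rw [prodPMF_apply, piPMF_apply, piPMF_apply, Fintype.prod_eq_mul_prod_subtype_ne _ j]
    congr 1
    · simp [e, Equiv.funSplitAt]
    · exact Finset.prod_congr rfl fun i _ => by simp [e, Equiv.funSplitAt, i.2, h i i.2]
  have update_e (b a : α) (y : {i // i ≠ j} → α) :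
      Function.update (e (b, y)) j a = e (a, y) := by
    ext i
    by_cases hi : i = j <;> simp [e, Equiv.funSplitAt, Function.update_apply, hi]
  rw [← bind_equiv _ (split h), ← bind_equiv _ (split fun _ _ => rfl), prodPMF_bind, prodPMF_bind]
  simp only [update_e]
  rw [PMF.bind_const, PMF.bind_comm]

theorem adv_piPMF_bind_le {s : Set β} {μ ν : ι → PMF α} {G : (ι → α) → PMF β} {ε : ℝ}
    (h : ∀ j u, adv s ((μ j).bind fun a => G (Function.update u j a))
      ((ν j).bind fun a => G (Function.update u j a)) ≤ ε) :
    adv s ((piPMF μ).bind G) ((piPMF ν).bind G) ≤ Fintype.card ι * ε := by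
  have hybrid (J : Finset ι) :
      adv s ((piPMF μ).bind G) ((piPMF (J.piecewise ν μ)).bind G) ≤ J.card * ε := by
    induction J using Finset.induction_on with
    | empty => simp [adv_self]
    | insert j J hj ih =>
      have agree : ∀ i ≠ j, (insert j J).piecewise ν μ i = J.piecewise ν μ i := fun i hi => by
        rw [Finset.piecewise_insert, Function.update_of_ne hi]
      have change : adv s ((piPMF (J.piecewise ν μ)).bind G)
          ((piPMF ((insert j J).piecewise ν μ)).bind G) ≤ ε := by
        rw [piPMF_bind_update agree, piPMF_bind_update (j := j) fun _ _ => rfl,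
          Finset.piecewise_insert_self, Finset.piecewise_eq_of_notMem _ _ _ hj]
        exact adv_bind_le _ (h j)
      rw [Finset.card_insert_of_notMem hj, Nat.cast_add_one, add_one_mul]
      exact (adv_triangle s _ _ _).trans (add_le_add ih change)
  simpa only [Finset.piecewise_univ, Finset.card_univ] using hybrid Finset.univ

/-- A family of independent samples of `μ`. -/
abbrev iid (ι : Type*) [Fintype ι] [DecidableEq ι] (μ : PMF α) : PMF (ι → α) := piPMF fun _ => μ

theorem iid_uniform [Nonempty α] :
    iid ι (PMF.uniformOfFintype α) = PMF.uniformOfFintype (ι → α) := by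
  ext x
  simp [piPMF_apply, ENNReal.inv_pow]

theorem iid_map [Fintype β] (μ : PMF α) (f : α → β) :
    (iid ι μ).map (fun u i => f (u i)) = iid ι (μ.map f) := by
  classical
  ext y
  simp only [PMF.map_apply, piPMF_apply, tsum_fintype, Finset.prod_univ_sum, Fintype.piFinset_univ,
    Finset.prod_ite_zero, funext_iff, Finset.mem_univ, true_implies]

theorem exists_adv_iid_bind_le [Nonempty ι] (s : Set β) (π₁ π₂ : PMF α) (G : (ι → α) → PMF β) :
    ∃ j u, adv s ((iid ι π₁).bind G) ((iid ι π₂).bind G) ≤ Fintype.card ι *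
      adv s (π₁.bind fun a => G (Function.update u j a))
        (π₂.bind fun a => G (Function.update u j a)) := by
  have : Nonempty α := π₁.support_nonempty.to_type
  obtain ⟨⟨j, u⟩, hmax⟩ := Finite.exists_max fun x : ι × (ι → α) =>
    adv s (π₁.bind fun a => G (Function.update x.2 x.1 a))
      (π₂.bind fun a => G (Function.update x.2 x.1 a))
  exact ⟨j, u, adv_piPMF_bind_le fun j' u' => hmax (j', u')⟩

theorem adv_iid_bind_le_tvDist (s : Set β) (P Q : PMF α) (G : (ι → α) → PMF β) :
    adv s ((iid ι P).bind G) ((iid ι Q).bind G) ≤ Fintype.card ι * tvDist P Q :=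
  adv_piPMF_bind_le fun _ _ => adv_bind_le_tvDist s P Q _

end Independent

/-! ### The leftover hash lemma -/

section LeftoverHash

variable {K X W : Type*} [Fintype K] [Fintype X] [Fintype W]

/-- The probability that two independent samples of `P` coincide. -/
def collisionProb (P : PMF W) : ℝ := ∑ w, (P w).toReal ^ 2

theorem sq_two_mul_tvDist_uniform_le [Nonempty W] (P : PMF W) :
    (2 * tvDist P (.uniformOfFintype W)) ^ 2 ≤ Fintype.card W * collisionProb P - 1 := by
  set c : ℝ := (Fintype.card W : ℝ) with hc
  have hc0 : c ≠ 0 := by simp [hc]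
  have square (w : W) : |(P w).toReal - (PMF.uniformOfFintype W w).toReal| ^ 2 =
      (P w).toReal ^ 2 - 2 * c⁻¹ * (P w).toReal + c⁻¹ ^ 2 := by
    rw [sq_abs, PMF.uniformOfFintype_apply, ENNReal.toReal_inv, ENNReal.toReal_natCast]
    ring
  calc (2 * tvDist P (.uniformOfFintype W)) ^ 2
      = (∑ w, |(P w).toReal - (PMF.uniformOfFintype W w).toReal|) ^ 2 := by rw [tvDist]; ring
    _ ≤ c * ∑ w, |(P w).toReal - (PMF.uniformOfFintype W w).toReal| ^ 2 := by
        simpa only [Finset.card_univ] using sq_sum_le_card_mul_sum_sq (s := Finset.univ)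
    _ = c * collisionProb P - 1 := by
        simp only [square, Finset.sum_add_distrib, Finset.sum_sub_distrib, ← Finset.mul_sum,
          sum_toReal, Finset.sum_const, Finset.card_univ, nsmul_eq_mul, ← hc, collisionProb]
        field_simp
        ring

open Classical in
theorem prob_eq_sum (s : Set X) (P : PMF X) :
    prob s P = ∑ x, (P x).toReal * if x ∈ s then 1 else 0 := by
  rw [prob, PMF.toOuterMeasure_apply_fintype, ENNReal.toReal_sum]
  · refine Finset.sum_congr rfl fun x _ => ?_
    split_ifs with hx <;> simp [hx]
  · exact fun x _ => ne_top_of_le_ne_top (P.apply_ne_top x) (Set.indicator_le_self _ _ _)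

open Classical in
theorem collisionProb_map (P : PMF X) (f : X → W) :
    collisionProb (P.map f) =
      ∑ x, ∑ x', (P x).toReal * (P x').toReal * if f x = f x' then 1 else 0 := by
  have apply (w : W) : ((P.map f) w).toReal = ∑ x, (P x).toReal * if f x = w then 1 else 0 := by
    rw [← PMF.toOuterMeasure_apply_singleton, ← prob, prob_map, prob_eq_sum]
    rfl
  simp only [collisionProb, apply, sq, Finset.sum_mul_sum]
  rw [Finset.sum_comm]
  refine Finset.sum_congr rfl fun x _ => ?_
  rw [Finset.sum_comm]
  refine Finset.sum_congr rfl fun x' _ => ?_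
  rw [Finset.sum_eq_single (f x')] <;> simp +contextual [eq_comm]

theorem sum_toReal_mul_collisionProb_map (π : PMF K) (P : PMF X) (h : K → X → W) :
    ∑ k, (π k).toReal * collisionProb (P.map (h k)) =
      ∑ x, ∑ x', (P x).toReal * (P x').toReal * prob {k | h k x = h k x'} π := by
  classical
  simp only [collisionProb_map, prob_eq_sum, Set.mem_ofPred_eq, Finset.mul_sum]
  rw [Finset.sum_comm]
  refine Finset.sum_congr rfl fun x _ => ?_
  rw [Finset.sum_comm]
  refine Finset.sum_congr rfl fun x' _ => Finset.sum_congr rfl fun k _ => ?_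
  ring

theorem leftover_hash [Nonempty W] (π : PMF K) (P : PMF X) (h : K → X → W) :
    (∑ k, (π k).toReal * (2 * tvDist (P.map (h k)) (.uniformOfFintype W))) ^ 2 ≤
      Fintype.card W *
        (∑ x, ∑ x', (P x).toReal * (P x').toReal * prob {k | h k x = h k x'} π) - 1 :=
  calc (∑ k, (π k).toReal * (2 * tvDist (P.map (h k)) (.uniformOfFintype W))) ^ 2
      ≤ ∑ k, (π k).toReal * (2 * tvDist (P.map (h k)) (.uniformOfFintype W)) ^ 2 :=
        Real.pow_arith_mean_le_arith_mean_pow_of_even _ _ _ (fun _ _ => ENNReal.toReal_nonneg)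
          (sum_toReal π) even_two
    _ ≤ ∑ k, (π k).toReal * (Fintype.card W * collisionProb (P.map (h k)) - 1) := by
        gcongr with k
        exact sq_two_mul_tvDist_uniform_le _
    _ = _ := by
        simp only [mul_sub, Finset.sum_sub_distrib, mul_one, sum_toReal, mul_left_comm,
          ← Finset.mul_sum, sum_toReal_mul_collisionProb_map]

theorem prob_uniform_ker {G : Type*} [AddGroup G] [Fintype G] [AddGroup W] {f : G →+ W}
    (hf : Function.Surjective f) :
    prob {x | f x = 0} (.uniformOfFintype G) = (Fintype.card W : ℝ)⁻¹ := by
  classical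
  have index : Nat.card G = Nat.card W * Nat.card f.ker := by
    rw [AddSubgroup.card_eq_card_quotient_mul_card_addSubgroup f.ker,
      Nat.card_congr (QuotientAddGroup.quotientKerEquivOfSurjective f hf).toEquiv]
  have ker_pos : (Nat.card f.ker : ℝ) ≠ 0 := Nat.cast_ne_zero.2 Nat.card_pos.ne'
  rw [prob, PMF.toOuterMeasure_uniformOfFintype_apply, ENNReal.toReal_div, ENNReal.toReal_natCast,
    ENNReal.toReal_natCast, ← Nat.card_eq_fintype_card, ← Nat.card_eq_fintype_card,
    ← Nat.card_eq_fintype_card, index, Nat.cast_mul]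
  exact div_mul_cancel_right₀ ker_pos _

end LeftoverHash

/-! ### The ternary hash -/

theorem mulVec_surjective {R m n : Type*} [CommRing R] [Fintype n] {z : n → R} {i : n}
    (hz : IsUnit (z i)) : Function.Surjective fun B : Matrix m n R => B *ᵥ z := by
  classical
  obtain ⟨u, hu⟩ := hz.exists_left_inv
  refine fun w => ⟨Matrix.vecMulVec w (Pi.single i u), ?_⟩
  simp [Matrix.vecMulVec_mulVec, hu]

theorem prob_mulVec_eq {R : Type*} [CommRing R] [Fintype R] {m n : Type*} [Fintype m] [Fintype n]
    [DecidableEq m] [DecidableEq n] {x y : n → R} {i : n} (h : IsUnit (x i - y i)) :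
    prob {B : Matrix m n R | B *ᵥ x = B *ᵥ y} (.uniformOfFintype _) =
      ((Fintype.card R : ℝ) ^ Fintype.card m)⁻¹ := by
  let f : Matrix m n R →+ (m → R) :=
    { toFun B := B *ᵥ (x - y), map_zero' := Matrix.zero_mulVec _
      map_add' B B' := Matrix.add_mulVec B B' _ }
  have hf : Function.Surjective f := mulVec_surjective (i := i) h
  simpa [f, Matrix.mulVec_sub, sub_eq_zero] using prob_uniform_ker hf

/-- A ternary vector, regarded modulo `q`. -/
def ternaryVec {ι : Type*} (q : ℕ) (r : ι → ZMod 3) : ι → ZMod q :=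
  fun i => (centered (r i) : ZMod q)

/-- No two corresponding entries, taken in `{-1, 0, 1}`, differ by `±1`. These are the pairs of
ternary vectors whose difference need not have an invertible entry modulo `q`. -/
def NoUnitDiff {ι : Type*} (r r' : ι → ZMod 3) : Prop :=
  ∀ i, ¬ (centered (r i) - centered (r' i) = 1 ∨ centered (r i) - centered (r' i) = -1)

instance {ι : Type*} [Fintype ι] (r r' : ι → ZMod 3) : Decidable (NoUnitDiff r r') :=
  inferInstanceAs (Decidable (∀ _, _))

theorem sum_noUnitDiff (ι : Type*) [Fintype ι] [DecidableEq ι] :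
    (∑ r : ι → ZMod 3, ∑ r' : ι → ZMod 3, if NoUnitDiff r r' then (1 : ℝ) else 0) =
      5 ^ Fintype.card ι := by
  have e : {x : (ι → ZMod 3) × (ι → ZMod 3) // NoUnitDiff x.1 x.2} ≃
      (ι → {x : ZMod 3 × ZMod 3 //
        ¬ (centered x.1 - centered x.2 = 1 ∨ centered x.1 - centered x.2 = -1)}) :=
    { toFun x i := ⟨(x.1.1 i, x.1.2 i), x.2 i⟩
      invFun y := ⟨(fun i => (y i).1.1, fun i => (y i).1.2), fun i => (y i).2⟩ }
  have five : Fintype.card {x : ZMod 3 × ZMod 3 //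
      ¬ (centered x.1 - centered x.2 = 1 ∨ centered x.1 - centered x.2 = -1)} = 5 := by decide
  rw [← Fintype.sum_prod_type' (f := fun r r' => if NoUnitDiff r r' then (1 : ℝ) else 0),
    Finset.sum_boole, ← Fintype.card_subtype, Fintype.card_congr e, Fintype.card_fun, five]
  norm_num

/-- The distribution of the hash value `B r` of a uniformly random ternary vector `r`. -/
def ternaryHash {n t q : ℕ} (B : Matrix (Fin n) (Fin t) (ZMod q)) : PMF (Fin n → ZMod q) :=
  (uniformVec t 3).map fun r => B *ᵥ ternaryVec q r

theorem prob_ternary_collision_le {n t q : ℕ} [NeZero q] (r r' : Fin t → ZMod 3) :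
    prob {B | B *ᵥ ternaryVec q r = B *ᵥ ternaryVec q r'} (uniformMatrix n t q) ≤
      ((q : ℝ) ^ n)⁻¹ + (1 - ((q : ℝ) ^ n)⁻¹) * if NoUnitDiff r r' then 1 else 0 := by
  split_ifs with h
  · simpa using prob_le_one _ _
  · simp only [NoUnitDiff, not_forall, not_not] at h
    obtain ⟨i, hi⟩ := h
    have unit : IsUnit (ternaryVec q r i - ternaryVec q r' i) := by
      rw [ternaryVec, ternaryVec, ← Int.cast_sub]
      rcases hi with hi | hi <;> simp [hi]
    rw [uniformMatrix, prob_mulVec_eq unit, ZMod.card, Fintype.card_fin, mul_zero, add_zero]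

theorem sq_sum_tvDist_ternaryHash_le (n t q : ℕ) [NeZero q] :
    (∑ B : Matrix (Fin n) (Fin t) (ZMod q), (uniformMatrix n t q B).toReal *
      (2 * tvDist (ternaryHash B) (uniformVec n q))) ^ 2 ≤ (5 / 9) ^ t * ((q : ℝ) ^ n - 1) := by
  have hQ : (q : ℝ) ^ n ≠ 0 := pow_ne_zero _ (NeZero.ne _)
  refine (leftover_hash (uniformMatrix n t q) (uniformVec t 3)
    fun B r => B *ᵥ ternaryVec q r).trans ?_
  have weight (r : Fin t → ZMod 3) : (uniformVec t 3 r).toReal = (3 ^ t)⁻¹ := by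
    simp [uniformVec]
  have nine : (3 : ℝ) ^ t * 3 ^ t = 9 ^ t := by rw [← mul_pow]; norm_num
  calc _ ≤ (q : ℝ) ^ n * (∑ r : Fin t → ZMod 3, ∑ r' : Fin t → ZMod 3, (3 ^ t)⁻¹ * (3 ^ t)⁻¹ *
          (((q : ℝ) ^ n)⁻¹ + (1 - ((q : ℝ) ^ n)⁻¹) * if NoUnitDiff r r' then 1 else 0)) - 1 := by
        simp only [weight, Fintype.card_fun, ZMod.card, Fintype.card_fin, Nat.cast_pow]
        gcongr with r _ r' _
        exact prob_ternary_collision_le r r'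
    _ = (q : ℝ) ^ n * ((9 ^ t)⁻¹ * (9 ^ t * ((q : ℝ) ^ n)⁻¹ +
          (1 - ((q : ℝ) ^ n)⁻¹) * 5 ^ t)) - 1 := by
        simp only [← Finset.mul_sum, Finset.sum_add_distrib, sum_noUnitDiff, Finset.sum_const,
          Finset.card_univ, Fintype.card_fun, ZMod.card, Fintype.card_fin, nsmul_eq_mul,
          Nat.cast_pow, Nat.cast_ofNat, ← mul_inv, ← nine]
        ring
    _ = (5 / 9) ^ t * ((q : ℝ) ^ n - 1) := by
        rw [div_pow]
        field_simp
        ring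

theorem sq_five_ninths_pow_mul_le {Q : ℝ} {t : ℕ} (hQ : 1 ≤ Q) (h : Q ^ 2 ≤ 2 ^ t) :
    ((5 / 9) ^ t * (Q - 1)) ^ 2 ≤ Q⁻¹ := by
  have hQ0 : 0 < Q := one_pos.trans_le hQ
  have eighth : (((5 / 9 : ℝ) ^ t) ^ 2 * Q ^ 3) ^ 2 ≤ 1 :=
    calc (((5 / 9 : ℝ) ^ t) ^ 2 * Q ^ 3) ^ 2 = ((5 / 9) ^ t) ^ 4 * (Q ^ 2) ^ 3 := by ring
      _ ≤ ((5 / 9) ^ t) ^ 4 * (2 ^ t) ^ 3 := by gcongr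
      _ = (5000 / 6561) ^ t := by
        rw [pow_right_comm, pow_right_comm 2, ← mul_pow]
        norm_num
      _ ≤ 1 := pow_le_one₀ (by norm_num) (by norm_num)
  rw [← one_div, le_div_iff₀ hQ0]
  calc ((5 / 9) ^ t * (Q - 1)) ^ 2 * Q ≤ ((5 / 9) ^ t * Q) ^ 2 * Q := by
        gcongr
        linarith
    _ = ((5 / 9) ^ t) ^ 2 * Q ^ 3 := by ring
    _ ≤ 1 := (sq_le_one_iff₀ (by positivity)).1 eighth

/-- A matrix, given by its columns. -/
def ofCols {m d α : Type*} : (d → m → α) ≃ Matrix m d α := (Equiv.piComm _).trans Matrix.of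

theorem uniformMatrix_bind_cols {a d q : ℕ} [NeZero q] {β : Type*}
    (F : Matrix (Fin a) (Fin d) (ZMod q) → PMF β) :
    (uniformMatrix a d q).bind F = (iid (Fin d) (uniformVec a q)).bind fun c => F (ofCols c) := by
  rw [uniformVec, iid_uniform, uniform_bind_equiv ofCols, uniformMatrix]

theorem adv_mul_ternary_le {n t d q : ℕ} [NeZero q] (B : Matrix (Fin n) (Fin t) (ZMod q))
    {β : Type*} (s : Set β) (F : Matrix (Fin n) (Fin d) (ZMod q) → PMF β) :
    adv s ((uniformMatrix t d 3).bind fun R => F (B * ternary q R)) ((uniformMatrix n d q).bind F) ≤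
      d * tvDist (ternaryHash B) (uniformVec n q) := by
  have hashed : ((uniformMatrix t d 3).bind fun R => F (B * ternary q R)) =
      (iid (Fin d) (ternaryHash B)).bind fun c => F (ofCols c) := by
    rw [uniformMatrix_bind_cols, ternaryHash, ← iid_map, PMF.bind_map]
    rfl
  rw [hashed, uniformMatrix_bind_cols]
  simpa only [Fintype.card_fin] using
    adv_iid_bind_le_tvDist (ι := Fin d) s (ternaryHash B) (uniformVec n q) fun c => F (ofCols c)

/-! ### The hash under the SIS assumption -/

/-- The circuit that answers every SIS instance with the first standard basis vector. -/
def basisCircuit (ι : Type) (t : ℕ) : Circuit ι (Fin t × Fin (1 + 1)) where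
  gates := []
  output z := .const (decide (z.1.val = 0 ∧ z.2 = 1))

theorem decodeInt_basisCircuit {ι : Type} {t : ℕ} (x : ι → Bool) (i : Fin t) :
    decodeInt (fun b => (basisCircuit ι t).eval x (i, b)) = if i.val = 0 then 1 else 0 := by
  have succ_zero : (0 : Fin 1).succ = (1 : Fin (1 + 1)) := rfl
  rw [decodeInt, Fin.sum_univ_one]
  by_cases hi : i.val = 0 <;> simp [basisCircuit, Circuit.eval, Wire.value, hi, succ_zero]

theorem le_prob_bind {α β : Type*} [Finite α] {s : Set β} (P : PMF α) {f : α → PMF β} {ε : ℝ}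
    (h : ∀ a, ε ≤ prob s (f a)) : ε ≤ prob s (P.bind f) :=
  have := Fintype.ofFinite α
  calc ε = ∑ a, (P a).toReal * ε := by rw [← Finset.sum_mul, sum_toReal, one_mul]
    _ ≤ ∑ a, (P a).toReal * prob s (f a) := by gcongr with a; exact h a
    _ = prob s (P.bind f) := (prob_bind s P f).symm

theorem toReal_apply_le_prob {α : Type*} {s : Set α} {a : α} (h : a ∈ s) (P : PMF α) :
    (P a).toReal ≤ prob s P := by
  rw [← PMF.toOuterMeasure_apply_singleton]
  exact ENNReal.toReal_mono (ne_top_of_le_ne_top ENNReal.one_ne_top (toOuterMeasure_le_one s P))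
    (MeasureTheory.measure_mono (Set.singleton_subset_iff.2 h))

theorem inv_le_sisSuccess_basisCircuit {n t q : ℕ} [NeZero q] (ht : 0 < t) {β : ℝ} (hβ : 1 ≤ β) :
    ((q : ℝ) ^ n)⁻¹ ≤ sisSuccess β (basisCircuit (SISBits n t q) t) := by
  let e₁ : Fin t → ℤ := fun i => if i.val = 0 then 1 else 0
  refine le_prob_bind _ fun A => ?_
  let h : Fin n → ZMod q := A *ᵥ fun i => (e₁ i : ZMod q)
  have solved : IsSISSolution β A h e₁ := by
    refine ⟨fun h0 => by simpa [e₁] using congrFun h0 ⟨0, ht⟩, fun i => ?_, rfl⟩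
    by_cases hi : i.val = 0 <;> simp [e₁, hi] <;> linarith
  calc ((q : ℝ) ^ n)⁻¹ = (uniformVec n q h).toReal := by simp [uniformVec]
    _ ≤ prob ((A, ·) ⁻¹' _) (uniformVec n q) := toReal_apply_le_prob (by
        simpa only [Set.mem_preimage, Set.mem_ofPred_eq, decodeInt_basisCircuit] using solved) _
    _ = _ := (prob_map _ _ (A, ·)).symm

theorem pow_le_two_pow_of_logb_le {n t q : ℕ} (hq : 0 < q)
    (ht : 2 * (n : ℝ) * Real.logb 2 q ≤ t) : ((q : ℝ) ^ n) ^ 2 ≤ 2 ^ t :=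
  calc ((q : ℝ) ^ n) ^ 2 = ((2 : ℝ) ^ Real.logb 2 q) ^ (2 * n) := by
        rw [Real.rpow_logb (by norm_num) (by norm_num) (by exact_mod_cast hq)]
        ring
    _ = (2 : ℝ) ^ (2 * (n : ℝ) * Real.logb 2 q) := by
        rw [← Real.rpow_natCast, ← Real.rpow_mul (by norm_num)]
        push_cast
        ring_nf
    _ ≤ (2 : ℝ) ^ (t : ℝ) := Real.rpow_le_rpow_of_exponent_le (by norm_num) ht
    _ = 2 ^ t := Real.rpow_natCast _ _

theorem sq_five_ninths_pow_mul_le_sisSuccess {n t q : ℕ} [NeZero q] (hq : 2 ≤ q)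
    (ht : 2 * (n : ℝ) * Real.logb 2 q ≤ t) {β : ℝ} (hβ : 1 ≤ β) :
    ((5 / 9) ^ t * ((q : ℝ) ^ n - 1)) ^ 2 ≤
      sisSuccess β (basisCircuit (SISBits n t q) t) := by
  have hpow := pow_le_two_pow_of_logb_le (by omega) ht
  rcases Nat.eq_zero_or_pos n with rfl | hn
  · have : 0 ≤ sisSuccess β (basisCircuit (SISBits 0 t q) t) := ENNReal.toReal_nonneg
    simpa
  · have hQ : 1 < (q : ℝ) ^ n := one_lt_pow₀ (by exact_mod_cast hq) hn.ne'
    have t_ne_zero : t ≠ 0 := by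
      rintro rfl
      nlinarith
    exact (sq_five_ninths_pow_mul_le hQ.le hpow).trans
      (inv_le_sisSuccess_basisCircuit (Nat.pos_of_ne_zero t_ne_zero) hβ)

theorem sum_tvDist_ternaryHash_le_sisSuccess {n t q : ℕ} [NeZero q] (hq : 2 ≤ q)
    (ht : 2 * (n : ℝ) * Real.logb 2 q ≤ t) {β : ℝ} (hβ : 1 ≤ β) :
    ∑ B : Matrix (Fin n) (Fin t) (ZMod q), (uniformMatrix n t q B).toReal *
      tvDist (ternaryHash B) (uniformVec n q) ≤
        √√(sisSuccess β (basisCircuit (SISBits n t q) t)) := by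
  set avg := ∑ B : Matrix (Fin n) (Fin t) (ZMod q), (uniformMatrix n t q B).toReal *
    tvDist (ternaryHash B) (uniformVec n q)
  have nonneg : 0 ≤ avg := Finset.sum_nonneg fun B _ =>
    mul_nonneg ENNReal.toReal_nonneg (by unfold tvDist; positivity)
  have sq_le : (2 * avg) ^ 2 ≤ (5 / 9) ^ t * ((q : ℝ) ^ n - 1) := by
    simpa only [avg, mul_left_comm _ (2 : ℝ), ← Finset.mul_sum] using
      sq_sum_tvDist_ternaryHash_le n t q
  refine Real.le_sqrt_of_sq_le (Real.le_sqrt_of_sq_le ?_)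
  calc (avg ^ 2) ^ 2 ≤ ((2 * avg) ^ 2) ^ 2 := by gcongr; linarith
    _ ≤ ((5 / 9) ^ t * ((q : ℝ) ^ n - 1)) ^ 2 := by gcongr
    _ ≤ _ := sq_five_ninths_pow_mul_le_sisSuccess hq ht hβ

theorem adv_uniformMatrix_bind_le_sisSuccess {n t q : ℕ} [NeZero q] (hq : 2 ≤ q)
    (ht : 2 * (n : ℝ) * Real.logb 2 q ≤ t) {β : ℝ} (hβ : 1 ≤ β) {γ : Type*} {s : Set γ} (d : ℕ)
    {f g : Matrix (Fin n) (Fin t) (ZMod q) → PMF γ}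
    (h : ∀ B, adv s (f B) (g B) ≤ d * tvDist (ternaryHash B) (uniformVec n q)) :
    adv s ((uniformMatrix n t q).bind f) ((uniformMatrix n t q).bind g) ≤
      d * √√(sisSuccess β (basisCircuit (SISBits n t q) t)) :=
  calc adv s ((uniformMatrix n t q).bind f) ((uniformMatrix n t q).bind g)
      ≤ ∑ B, (uniformMatrix n t q B).toReal *
          (d * tvDist (ternaryHash B) (uniformVec n q)) := by
        refine (adv_bind_le_sum s _ f g).trans ?_
        gcongr with B
        exact h B
    _ = d * ∑ B, (uniformMatrix n t q B).toReal * tvDist (ternaryHash B) (uniformVec n q) := by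
        simp only [mul_left_comm _ (d : ℝ), ← Finset.mul_sum]
    _ ≤ _ := by
        gcongr
        exact sum_tvDist_ternaryHash_le_sisSuccess hq ht hβ

/-! ### Building circuits -/

section Circuits

variable {ι κ o : Type}

theorem gateValues_append_singleton (x : ι → Bool) (Γ : List (Wire ι × Wire ι))
    (g : Wire ι × Wire ι) :
    gateValues x (Γ ++ [g]) = gateValues x Γ ++
      [!(g.1.value x (gateValues x Γ) && g.2.value x (gateValues x Γ))] := by
  simp [gateValues, List.foldl_append]

theorem length_gateValues (x : ι → Bool) (Γ : List (Wire ι × Wire ι)) :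
    (gateValues x Γ).length = Γ.length := by
  induction Γ using List.reverseRecOn with
  | nil => rfl
  | append_singleton Γ g ih => simp [gateValues_append_singleton, ih]

theorem gateValues_prefix_append (x : ι → Bool) (Γ Γ' : List (Wire ι × Wire ι)) :
    gateValues x Γ <+: gateValues x (Γ ++ Γ') := by
  induction Γ' using List.reverseRecOn with
  | nil => rw [List.append_nil]
  | append_singleton Γ' g ih =>
    rw [← List.append_assoc, gateValues_append_singleton]
    exact ih.trans (List.prefix_append _ _)

/-- The Boolean functions of the input that can be read off the wires of a circuit with gates
`Γ`. -/
def Readable (Γ : List (Wire ι × Wire ι)) : Set ((ι → Bool) → Bool) :=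
  Set.range fun (w : Wire ι) x => w.value x (gateValues x Γ)

theorem readable_subset_append (Γ Γ' : List (Wire ι × Wire ι)) :
    Readable Γ ⊆ Readable (Γ ++ Γ') := by
  rintro _ ⟨w, rfl⟩
  cases w with
  | input i => exact ⟨.input i, rfl⟩
  | const b => exact ⟨.const b, rfl⟩
  | gate k =>
    rcases lt_or_ge k Γ.length with hk | hk
    · refine ⟨.gate k, funext fun x => ?_⟩
      obtain ⟨l, hl⟩ := gateValues_prefix_append x Γ Γ'
      simp only [Wire.value]
      rw [← hl, List.getD_append _ _ _ _ (by rwa [length_gateValues])]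
    · refine ⟨.const false, funext fun x => ?_⟩
      simp only [Wire.value]
      rw [List.getD_eq_default _ _ (by rwa [length_gateValues])]

/-- Any circuit in which the functions in `T` can be read off can be extended by at most `s` gates
so that those in `U` can be read off as well. -/
def Buildable (s : ℕ) (T U : Set ((ι → Bool) → Bool)) : Prop :=
  ∀ Γ, T ⊆ Readable Γ → ∃ Γ' : List (Wire ι × Wire ι), Γ'.length ≤ s ∧ U ⊆ Readable (Γ ++ Γ')

namespace Buildable

variable {s s' : ℕ} {T U U' V : Set ((ι → Bool) → Bool)} {f g h : (ι → Bool) → Bool}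

theorem mono (H : Buildable s T U) (hs : s ≤ s') (hU : U' ⊆ U) : Buildable s' T U' := fun Γ hT =>
  let ⟨Γ', hΓ', hUΓ⟩ := H Γ hT
  ⟨Γ', hΓ'.trans hs, hU.trans hUΓ⟩

theorem of_subset (h : U ⊆ T) : Buildable 0 T U := fun Γ hT =>
  ⟨[], le_rfl, by rw [List.append_nil]; exact h.trans hT⟩

theorem trans (H : Buildable s T U) (H' : Buildable s' U V) : Buildable (s + s') T V := by
  intro Γ hT
  obtain ⟨Γ₁, h₁, hU⟩ := H Γ hT
  obtain ⟨Γ₂, h₂, hV⟩ := H' _ hU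
  exact ⟨Γ₁ ++ Γ₂, by rw [List.length_append]; exact add_le_add h₁ h₂,
    by rwa [← List.append_assoc]⟩

theorem union (H : Buildable s T U) (H' : Buildable s' T V) :
    Buildable (s + s') T (U ∪ V) := by
  intro Γ hT
  obtain ⟨Γ₁, h₁, hU⟩ := H Γ hT
  obtain ⟨Γ₂, h₂, hV⟩ := H' _ (hT.trans (readable_subset_append Γ Γ₁))
  refine ⟨Γ₁ ++ Γ₂, by rw [List.length_append]; exact add_le_add h₁ h₂, ?_⟩
  rw [← List.append_assoc]
  exact Set.union_subset (hU.trans (readable_subset_append _ _)) hV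

theorem image {F : κ → (ι → Bool) → Bool} (H : ∀ j, Buildable s T {F j}) (J : Finset κ) :
    Buildable (J.card * s) T (F '' J) := by
  classical
  induction J using Finset.induction_on with
  | empty => simpa using of_subset (T := T) (Set.empty_subset T)
  | insert j J hj ih =>
    rw [Finset.card_insert_of_notMem hj, Finset.coe_insert, Set.image_insert_eq, Set.insert_eq,
      Nat.succ_mul, Nat.add_comm]
    exact (H j).union ih

theorem range [Fintype κ] {F : κ → (ι → Bool) → Bool} (H : ∀ j, Buildable s T {F j}) :
    Buildable (Fintype.card κ * s) T (Set.range F) := by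
  simpa only [Finset.coe_univ, Set.image_univ, Finset.card_univ] using image H Finset.univ

theorem of_mem (hf : f ∈ T) : Buildable 0 T {f} := of_subset (Set.singleton_subset_iff.2 hf)

theorem input (i : ι) : Buildable 0 T {fun x => x i} := fun _ _ =>
  ⟨[], le_rfl, Set.singleton_subset_iff.2 ⟨.input i, rfl⟩⟩

theorem const (b : Bool) : Buildable 0 T {fun _ => b} := fun _ _ =>
  ⟨[], le_rfl, Set.singleton_subset_iff.2 ⟨.const b, rfl⟩⟩

theorem nand_of_mem (hf : f ∈ T) (hg : g ∈ T) : Buildable 1 T {fun x => !(f x && g x)} := by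
  intro Γ hT
  obtain ⟨w, rfl⟩ := hT hf
  obtain ⟨w', rfl⟩ := hT hg
  refine ⟨[(w, w')], le_rfl, Set.singleton_subset_iff.2 ⟨.gate Γ.length, funext fun x => ?_⟩⟩
  simp [Wire.value, gateValues_append_singleton, length_gateValues, List.getD]

theorem nand (hf : Buildable s T {f}) (hg : Buildable s' T {g}) :
    Buildable (s + s' + 1) T {fun x => !(f x && g x)} :=
  (hf.union hg).trans (nand_of_mem (Or.inl rfl) (Or.inr rfl))

theorem not (hf : Buildable s T {f}) : Buildable (s + 1) T {fun x => !f x} := by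
  simpa only [Bool.and_self] using hf.trans (nand_of_mem (Set.mem_singleton f) rfl)

theorem and (hf : Buildable s T {f}) (hg : Buildable s' T {g}) :
    Buildable (s + s' + 2) T {fun x => f x && g x} := by
  simpa only [Bool.not_not] using (hf.nand hg).not

theorem or (hf : Buildable s T {f}) (hg : Buildable s' T {g}) :
    Buildable (s + s' + 3) T {fun x => f x || g x} := by
  have deMorgan := hf.not.nand hg.not
  simp only [Bool.not_and, Bool.not_not] at deMorgan
  exact deMorgan.mono (by omega) subset_rfl

theorem ite {a : ℕ} (hh : Buildable a T {h}) (hf : Buildable s T {f})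
    (hg : Buildable s' T {g}) :
    Buildable (2 * a + s + s' + 4) T {fun x => if h x then f x else g x} := by
  have eq_nand : (fun x => if h x then f x else g x) =
      fun x => !(!(h x && f x) && !(!h x && g x)) := by
    funext x
    cases h x <;> simp
  rw [eq_nand]
  exact ((hh.nand hf).nand (hh.not.nand hg)).mono (by omega) subset_rfl

theorem xor (hf : Buildable s T {f}) (hg : Buildable s' T {g}) :
    Buildable (2 * s + 2 * s' + 5) T {fun x => f x ^^ g x} := by
  have eq_ite : (fun x => f x ^^ g x) = fun x => if f x then !g x else g x := by
    funext x
    cases f x <;> simp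
  rw [eq_ite]
  exact (hf.ite hg.not hg).mono (by omega) subset_rfl

theorem wires (F : (ι → Bool) → κ → Bool) (Γ : List (Wire κ × Wire κ)) :
    Buildable Γ.length (Set.range fun j x => F x j)
      (Set.range fun (w : Wire κ) x => w.value (F x) (gateValues (F x) Γ)) := by
  induction Γ using List.reverseRecOn with
  | nil =>
    refine fun Γ hT => ⟨[], le_rfl, ?_⟩
    rintro _ ⟨w, rfl⟩
    cases w with
    | input j => rw [List.append_nil]; exact hT ⟨j, rfl⟩
    | gate k => exact ⟨.const false, by simp [Wire.value, gateValues]⟩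
    | const b => exact ⟨.const b, rfl⟩
  | append_singleton Γ g ih =>
    refine (ih.trans ((of_subset subset_rfl).union (nand_of_mem ⟨g.1, rfl⟩ ⟨g.2, rfl⟩))).mono
      (by simp) ?_
    rintro _ ⟨w, rfl⟩
    cases w with
    | input j => exact Or.inl ⟨.input j, rfl⟩
    | const b => exact Or.inl ⟨.const b, rfl⟩
    | gate k =>
      rcases lt_trichotomy k Γ.length with hk | rfl | hk
      · refine Or.inl ⟨.gate k, funext fun x => ?_⟩
        simp [Wire.value, gateValues_append_singleton, List.getD, length_gateValues, hk,
          List.getElem?_append_left]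
      · refine Or.inr (funext fun x => ?_)
        simp [Wire.value, gateValues_append_singleton, List.getD, length_gateValues]
      · refine Or.inl ⟨.const false, funext fun x => ?_⟩
        simp only [Wire.value]
        rw [List.getD_eq_default]
        simpa [length_gateValues] using hk

theorem exists_circuit {F : (ι → Bool) → o → Bool}
    (H : Buildable s ∅ (Set.range fun j x => F x j)) :
    ∃ D : Circuit ι o, D.gates.length ≤ s ∧ D.eval = F := by
  obtain ⟨Γ, hΓ, hF⟩ := H [] (Set.empty_subset _)
  choose w hw using Set.range_subset_iff.1 hF
  exact ⟨⟨Γ, w⟩, hΓ, funext fun x => funext fun j => congrFun (hw j) x⟩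

theorem exists_comp_circuit {F : (ι → Bool) → κ → Bool}
    (H : Buildable s ∅ (Set.range fun j x => F x j)) (D : Circuit κ Unit) :
    ∃ D' : Circuit ι Unit, D'.size ≤ s + D.size ∧ D'.eval = D.eval ∘ F := by
  obtain ⟨D', hD', heval⟩ := exists_circuit (o := Unit) (F := D.eval ∘ F)
    ((H.trans (wires F D.gates)).mono le_rfl
      (Set.range_subset_iff.2 fun j => ⟨D.output j, rfl⟩))
  refine ⟨D', ?_, heval⟩
  simp only [Circuit.size]
  omega

end Buildable

end Circuits

/-! ### Circuits for modular arithmetic -/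

section Arithmetic

variable {ι : Type} {T : Set ((ι → Bool) → Bool)}

theorem mod_two_pow_succ (m j : ℕ) :
    m % 2 ^ (j + 1) = m % 2 ^ j + if m.testBit j then 2 ^ j else 0 := by
  rw [Nat.mod_pow_succ, Nat.testBit_eq_decide_div_mod_eq]
  rcases Nat.mod_two_eq_zero_or_one (m / 2 ^ j) with h | h <;> simp [h]

theorem le_mod_two_pow_succ_iff (c m j : ℕ) :
    decide (c ≤ m % 2 ^ (j + 1)) =
      if c ≤ 2 ^ j then m.testBit j || decide (c ≤ m % 2 ^ j)
      else m.testBit j && decide (c - 2 ^ j ≤ m % 2 ^ j) := by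
  have hlt : m % 2 ^ j < 2 ^ j := Nat.mod_lt _ (by positivity)
  rw [mod_two_pow_succ]
  cases m.testBit j <;> by_cases hc : c ≤ 2 ^ j <;> simp [hc] <;> omega

-- The last term is the carry into position `j`.
theorem testBit_add_eq_xor (a b j : ℕ) :
    (a + b).testBit j =
      ((a.testBit j ^^ b.testBit j) ^^ decide (2 ^ j - b % 2 ^ j ≤ a % 2 ^ j)) := by
  have div_eq : (a + b) / 2 ^ j =
      a / 2 ^ j + b / 2 ^ j + if 2 ^ j - b % 2 ^ j ≤ a % 2 ^ j then 1 else 0 := by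
    rw [Nat.add_div (by positivity)]
    exact congrArg _ (if_congr (by omega) rfl rfl)
  simp only [Nat.testBit_eq_decide_div_mod_eq, div_eq]
  rcases Nat.mod_two_eq_zero_or_one (a / 2 ^ j) with ha | ha <;>
  rcases Nat.mod_two_eq_zero_or_one (b / 2 ^ j) with hb | hb <;>
  split_ifs with carry <;> simp [Nat.add_mod, ha, hb, carry]

theorem testBit_val_add {q j : ℕ} [NeZero q] (y a : ZMod q) (hj : j < Nat.clog 2 q) :
    (y + a).val.testBit j =
      if q - a.val ≤ y.val then (y.val + (a.val + (2 ^ Nat.clog 2 q - q))).testBit j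
      else (y.val + a.val).testBit j := by
  have hq : q ≤ 2 ^ Nat.clog 2 q := Nat.le_pow_clog one_lt_two q
  have ha := ZMod.val_lt a
  split_ifs with wrap
  · have sub_eq : y.val + (a.val + (2 ^ Nat.clog 2 q - q)) =
        2 ^ Nat.clog 2 q + (y.val + a.val - q) := by omega
    rw [ZMod.val_add_of_le (by omega), sub_eq, Nat.testBit_two_pow_add_gt hj]
  · rw [ZMod.val_add_of_lt (by omega)]

/-- The number of gates that add a constant modulo `q`, controlled by an input bit. -/
def modCost (q : ℕ) : ℕ := Nat.clog 2 q * (18 * Nat.clog 2 q + 22)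

/-- `f` is an affine form modulo `q` in the input bits. -/
def IsAffine [Fintype ι] {q : ℕ} (f : (ι → Bool) → ZMod q) : Prop :=
  ∃ (c : ZMod q) (a : ι → ZMod q), ∀ x, f x = c + ∑ i, if x i then a i else 0

namespace Buildable

theorem le_mod_two_pow {K : ℕ} {Y : (ι → Bool) → ℕ}
    (hT : ∀ j < K, (fun x => (Y x).testBit j) ∈ T) {j : ℕ} (hj : j ≤ K) (c : ℕ) :
    Buildable (3 * j) T {fun x => decide (c ≤ Y x % 2 ^ j)} := by
  induction j generalizing c with
  | zero => simpa only [pow_zero, Nat.mod_one] using const _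
  | succ j ih =>
    have bit := of_mem (hT j hj)
    simp only [le_mod_two_pow_succ_iff]
    split_ifs
    · exact (bit.or (ih (by omega) c)).mono (by omega) subset_rfl
    · exact (bit.and (ih (by omega) _)).mono (by omega) subset_rfl

theorem testBit_add_const {K : ℕ} {Y : (ι → Bool) → ℕ}
    (hT : ∀ j < K, (fun x => (Y x).testBit j) ∈ T) {j : ℕ} (hj : j < K) (c : ℕ) :
    Buildable (6 * K + 7) T {fun x => (Y x + c).testBit j} := by
  have xor_bit : Buildable 1 T {fun x => (Y x).testBit j ^^ c.testBit j} := by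
    cases c.testBit j
    · simpa using (of_mem (hT j hj)).mono zero_le_one subset_rfl
    · simpa using (of_mem (hT j hj)).not
  simp only [testBit_add_eq_xor]
  exact (xor_bit.xor (le_mod_two_pow hT hj.le _)).mono (by omega) subset_rfl

theorem testBit_add_ite {q : ℕ} [NeZero q] {Y : (ι → Bool) → ZMod q}
    (hT : ∀ j < Nat.clog 2 q, (fun x => (Y x).val.testBit j) ∈ T) (i : ι) (a : ZMod q) {j : ℕ}
    (hj : j < Nat.clog 2 q) :
    Buildable (18 * Nat.clog 2 q + 22) T
      {fun x => (Y x + if x i then a else 0).val.testBit j} := by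
  have val_mod (x : ι → Bool) : (Y x).val % 2 ^ Nat.clog 2 q = (Y x).val :=
    Nat.mod_eq_of_lt ((ZMod.val_lt _).trans_le (Nat.le_pow_clog one_lt_two q))
  have wrap := le_mod_two_pow (Y := fun x => (Y x).val) hT le_rfl (q - a.val)
  have sum (c : ℕ) := testBit_add_const (Y := fun x => (Y x).val) hT hj c
  have select := (input (T := T) i).ite
    (wrap.ite (sum (a.val + (2 ^ Nat.clog 2 q - q))) (sum a.val)) (of_mem (hT j hj))
  have eq_select (x : ι → Bool) : (Y x + if x i then a else 0).val.testBit j =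
      if x i then (Y x + a).val.testBit j else (Y x).val.testBit j := by
    cases x i <;> simp
  simp only [eq_select, testBit_val_add _ a hj]
  simp only [val_mod, decide_eq_true_eq] at select
  exact select.mono (by omega) subset_rfl

theorem affineSum {q : ℕ} [NeZero q] (c : ZMod q) (a : ι → ZMod q) (J : Finset ι) :
    Buildable (J.card * modCost q) ∅ (Set.range fun (j : Fin (Nat.clog 2 q)) (x : ι → Bool) =>
      (c + ∑ i ∈ J, if x i then a i else 0).val.testBit j) := by
  classical
  induction J using Finset.induction_on with
  | empty =>
    simpa using range (T := ∅) fun j : Fin (Nat.clog 2 q) =>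
      const (ι := ι) ((c + 0).val.testBit j)
  | insert i J hi ih =>
    simp only [Finset.sum_insert hi, Finset.card_insert_of_notMem hi, Nat.succ_mul]
    simp only [add_comm (if _ then _ else _), ← add_assoc]
    have addTerm (j : Fin (Nat.clog 2 q)) :
        Buildable (18 * Nat.clog 2 q + 22)
          (Set.range fun (j : Fin (Nat.clog 2 q)) (x : ι → Bool) =>
            (c + ∑ i ∈ J, if x i then a i else 0).val.testBit j)
          {fun x => (c + (∑ i ∈ J, if x i then a i else 0) + if x i then a i else 0).val.testBit
            j} :=
      testBit_add_ite (fun k hk => Set.mem_range_self (⟨k, hk⟩ : Fin _)) i (a i) j.2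
    refine ih.trans ((range addTerm).mono ?_ subset_rfl)
    rw [Fintype.card_fin, modCost]

variable [Fintype ι]

theorem isAffine {q : ℕ} [NeZero q] {f : (ι → Bool) → ZMod q} (hf : IsAffine f)
    (j : Fin (Nat.clog 2 q)) :
    Buildable (Fintype.card ι * modCost q) ∅ {fun x => (f x).val.testBit j} := by
  obtain ⟨c, a, hca⟩ := hf
  simp only [hca]
  exact (affineSum c a Finset.univ).mono le_rfl (Set.singleton_subset_iff.2 ⟨j, rfl⟩)

end Buildable

namespace IsAffine

variable [Fintype ι] {q : ℕ} {f g : (ι → Bool) → ZMod q}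

theorem const (c : ZMod q) : IsAffine fun _ : ι → Bool => c := ⟨c, 0, by simp⟩

theorem input (i : ι) : IsAffine fun x : ι → Bool => ((x i).toNat : ZMod q) := by
  classical
  refine ⟨0, Pi.single i 1, fun x => ?_⟩
  rw [Finset.sum_eq_single i]
  · cases h : x i <;> simp [h]
  · intro j _ hj
    simp [hj]
  · simp

theorem add (hf : IsAffine f) (hg : IsAffine g) : IsAffine fun x => f x + g x := by
  obtain ⟨c, a, hf⟩ := hf
  obtain ⟨c', a', hg⟩ := hg
  refine ⟨c + c', a + a', fun x => ?_⟩
  simp only [hf, hg]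
  rw [add_add_add_comm, ← Finset.sum_add_distrib]
  congr! 2 with i
  split_ifs <;> simp

theorem mul_const (hf : IsAffine f) (k : ZMod q) : IsAffine fun x => f x * k := by
  obtain ⟨c, a, hf⟩ := hf
  refine ⟨c * k, fun i => a i * k, fun x => ?_⟩
  simp only [hf, add_mul, Finset.sum_mul, ite_mul, zero_mul]

theorem sum {κ : Type*} {F : κ → (ι → Bool) → ZMod q} (J : Finset κ)
    (hF : ∀ k, IsAffine (F k)) : IsAffine fun x => ∑ k ∈ J, F k x := by
  classical
  induction J using Finset.induction_on with
  | empty => simpa only [Finset.sum_empty] using const 0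
  | insert k J hk ih => simpa only [Finset.sum_insert hk] using (hF k).add ih

theorem ofBits {w : ℕ} (e : Fin w → ι) :
    IsAffine fun x : ι → Bool => ((Nat.ofBits fun k => x (e k) : ℕ) : ZMod q) := by
  induction w with
  | zero => simpa only [Nat.ofBits_zero, Nat.cast_zero] using const 0
  | succ w ih =>
    simpa only [Nat.ofBits_succ, Function.comp_def, Nat.cast_add, Nat.cast_mul, mul_comm] using
      ((ih fun k => e k.succ).mul_const ((2 : ℕ) : ZMod q)).add (input (e 0))

end IsAffine

/-- The matrix over `ZMod q` whose entries have the binary digits `x`. Unlike in `encMat`, the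
number of digits of an entry is arbitrary, and the entries are reduced modulo `q`. -/
def decMat {a b w : ℕ} (q : ℕ) (x : Fin a × Fin b × Fin w → Bool) :
    Matrix (Fin a) (Fin b) (ZMod q) :=
  Matrix.of fun i j => ((Nat.ofBits fun k => x (i, j, k) : ℕ) : ZMod q)

/-- The vector over `ZMod q` whose entries have the binary digits `x`. -/
def decVec {a w : ℕ} (q : ℕ) (x : Fin a × Fin w → Bool) : Fin a → ZMod q :=
  fun i => ((Nat.ofBits fun k => x (i, k) : ℕ) : ZMod q)

theorem ofBits_testBit_val {q : ℕ} [NeZero q] (y : ZMod q) :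
    ((Nat.ofBits fun k : Fin (Nat.clog 2 q) => y.val.testBit k : ℕ) : ZMod q) = y := by
  rw [Nat.ofBits_testBit, Nat.mod_eq_of_lt, ZMod.natCast_zmod_val]
  exact (ZMod.val_lt y).trans_le (Nat.le_pow_clog one_lt_two q)

theorem decMat_encMat {a b q : ℕ} [NeZero q] (M : Matrix (Fin a) (Fin b) (ZMod q)) :
    decMat q (encMat M) = M :=
  Matrix.ext fun i j => ofBits_testBit_val (M i j)

theorem decVec_encVec {a q : ℕ} [NeZero q] (v : Fin a → ZMod q) : decVec q (encVec v) = v :=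
  funext fun i => ofBits_testBit_val (v i)

/-- The entries of the view `V x` are affine forms in the input bits `x`. -/
structure AffineView [Fintype ι] {p : Params} (V : (ι → Bool) → View p) : Prop where
  A : ∀ i j, IsAffine fun x => (V x).A i j
  B : ∀ i j, IsAffine fun x => (V x).B i j
  C : ∀ i j, IsAffine fun x => (V x).C i j
  C' : ∀ i j, IsAffine fun x => (V x).C' i j
  S : ∀ i j, IsAffine fun x => (V x).S i j
  Y : ∀ i j, IsAffine fun x => (V x).Y i j
  R : ∀ i j, IsAffine fun x => (V x).R i j
  H : ∀ i j, IsAffine fun x => (V x).H i j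

theorem AffineView.buildable_encode [Fintype ι] {p : Params} {V : (ι → Bool) → View p}
    (hV : AffineView V) :
    Buildable (Fintype.card (ViewBits p) * (Fintype.card ι * (modCost p.q + modCost 3))) ∅
      (Set.range fun z x => (V x).encode z) := by
  have entry {a b q : ℕ} [NeZero q] {M : (ι → Bool) → Matrix (Fin a) (Fin b) (ZMod q)}
      (hM : ∀ i j, IsAffine fun x => M x i j) (z : MatBits a b q)
      (hq : modCost q ≤ modCost p.q + modCost 3) :
      Buildable (Fintype.card ι * (modCost p.q + modCost 3)) ∅ {fun x => encMat (M x) z} :=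
    (Buildable.isAffine (hM z.1 z.2.1) z.2.2).mono (Nat.mul_le_mul_left _ hq) subset_rfl
  have le_left : modCost p.q ≤ modCost p.q + modCost 3 := Nat.le_add_right _ _
  refine Buildable.range fun z => ?_
  rcases z with z | z | z | z | z | z | z | z
  exacts [entry hV.A z le_left, entry hV.B z le_left, entry hV.C z le_left, entry hV.C' z le_left,
    entry hV.S z le_left, entry hV.Y z le_left, entry hV.R z (Nat.le_add_left _ _),
    entry hV.H z le_left]

end Arithmetic

/-! ### Sampling uniform residues with fair coins -/

section Sampling

variable {β : Type*}

theorem card_ofBits_cast_eq (q w : ℕ) [NeZero q] (z : ZMod q) :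
    (Finset.univ.filter fun x : Fin w → Bool => ((Nat.ofBits x : ℕ) : ZMod q) = z).card =
      Nat.count (· ≡ z.val [MOD q]) (2 ^ w) := by
  have cast_eq_iff (m : ℕ) : (m : ZMod q) = z ↔ m ≡ z.val [MOD q] := by
    rw [← ZMod.natCast_eq_natCast_iff, ZMod.natCast_zmod_val]
  rw [Nat.count_eq_card_filter_range]
  refine Finset.card_nbij' Nat.ofBits (fun m k => m.testBit k) ?_ ?_ ?_ ?_
  · intro x hx
    simpa [Nat.ofBits_lt_two_pow, cast_eq_iff] using hx
  · intro m hm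
    have hm' : m < 2 ^ w ∧ m ≡ z.val [MOD q] := by simpa using hm
    simp [Nat.ofBits_testBit, Nat.mod_eq_of_lt hm'.1, cast_eq_iff, hm'.2]
  · intro x _
    ext k
    simp
  · intro m hm
    have hm' : m < 2 ^ w ∧ m ≡ z.val [MOD q] := by simpa using hm
    rw [Nat.ofBits_testBit, Nat.mod_eq_of_lt hm'.1]

theorem abs_count_modEq_sub_div_le {q : ℕ} (hq : 0 < q) (m v : ℕ) :
    |(Nat.count (· ≡ v [MOD q]) m : ℝ) - m / q| ≤ 1 := by
  have hq' : (0 : ℝ) < q := by exact_mod_cast hq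
  have frac_nonneg : (0 : ℝ) ≤ (m % q : ℕ) / q := by positivity
  have frac_le_one : ((m % q : ℕ) : ℝ) / q ≤ 1 :=
    (div_le_one hq').2 (by exact_mod_cast (Nat.mod_lt m hq).le)
  have div_eq : (m : ℝ) / q = (m / q : ℕ) + (m % q : ℕ) / q := by
    field_simp
    exact_mod_cast (Nat.div_add_mod m q).symm
  rw [Nat.count_modEq_card m hq v, div_eq, abs_le]
  push_cast
  split_ifs <;> constructor <;> linarith

theorem tvDist_map_ofBits_uniform_le (q w : ℕ) [NeZero q] :
    tvDist ((PMF.uniformOfFintype (Fin w → Bool)).map fun x => ((Nat.ofBits x : ℕ) : ZMod q))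
      (PMF.uniformOfFintype (ZMod q)) ≤ q / 2 ^ w := by
  have deviation (z : ZMod q) :
      |(((PMF.uniformOfFintype (Fin w → Bool)).map fun x => ((Nat.ofBits x : ℕ) : ZMod q)) z).toReal
        - ((PMF.uniformOfFintype (ZMod q)) z).toReal| ≤ 1 / 2 ^ w := by
    have mass : (((PMF.uniformOfFintype (Fin w → Bool)).map
        fun x => ((Nat.ofBits x : ℕ) : ZMod q)) z).toReal =
          Nat.count (· ≡ z.val [MOD q]) (2 ^ w) / 2 ^ w := by
      rw [← card_ofBits_cast_eq, PMF.map_apply, tsum_fintype]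
      simp [Finset.sum_ite, eq_comm, div_eq_mul_inv]
    have h := abs_count_modEq_sub_div_le (Nat.pos_of_neZero q) (2 ^ w) z.val
    rw [mass, PMF.uniformOfFintype_apply, ZMod.card, ENNReal.toReal_inv, ENNReal.toReal_natCast]
    have : (Nat.count (· ≡ z.val [MOD q]) (2 ^ w) / 2 ^ w - (q : ℝ)⁻¹) =
        (Nat.count (· ≡ z.val [MOD q]) (2 ^ w) - (2 ^ w : ℕ) / q) / 2 ^ w := by
      push_cast
      field_simp
    rw [this, abs_div, abs_of_pos (show (0 : ℝ) < 2 ^ w by positivity)]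
    gcongr
  rw [tvDist]
  calc _ ≤ (∑ _z : ZMod q, (1 : ℝ) / 2 ^ w) / 2 := by gcongr with z; exact deviation z
    _ = q / 2 ^ w / 2 := by rw [Finset.sum_const, Finset.card_univ, ZMod.card, nsmul_eq_mul]; ring
    _ ≤ q / 2 ^ w := half_le_self (by positivity)

theorem uniformMatrix_bind_entries {a b q : ℕ} [NeZero q]
    (F : Matrix (Fin a) (Fin b) (ZMod q) → PMF β) :
    (uniformMatrix a b q).bind F =
      (iid (Fin a × Fin b) (PMF.uniformOfFintype (ZMod q))).bind fun u =>
        F (Matrix.of (Function.curry u)) := by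
  rw [iid_uniform]
  exact (uniform_bind_equiv ((Equiv.curry (Fin a) (Fin b) (ZMod q)).trans Matrix.of) F).symm

/-- The coins for an `a × b` matrix modulo `q`: each entry takes `κ` coins more than it has binary
digits, so that its residue is uniform up to an error of `2 ^ (-κ)`. -/
abbrev MatCoins (a b q κ : ℕ) : Type := Fin a × Fin b × Fin (Nat.clog 2 q + κ)

/-- The distribution of an `a × b` matrix modulo `q` sampled with fair coins. -/
def coinMatrix (a b q κ : ℕ) : PMF (Matrix (Fin a) (Fin b) (ZMod q)) :=
  (PMF.uniformOfFintype (MatCoins a b q κ → Bool)).map (decMat q)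

theorem coinMatrix_bind_entries {a b q κ : ℕ} [NeZero q]
    (F : Matrix (Fin a) (Fin b) (ZMod q) → PMF β) :
    (coinMatrix a b q κ).bind F =
      (iid (Fin a × Fin b) ((PMF.uniformOfFintype (Fin (Nat.clog 2 q + κ) → Bool)).map
        fun x => ((Nat.ofBits x : ℕ) : ZMod q))).bind fun u =>
          F (Matrix.of (Function.curry u)) := by
  rw [← iid_map, iid_uniform, PMF.bind_map, coinMatrix, PMF.bind_map]
  exact uniform_bind_equiv (((Equiv.prodAssoc (Fin a) (Fin b) (Fin _)).symm.arrowCongr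
    (Equiv.refl Bool)).trans (Equiv.curry _ _ _))
      fun u => F (Matrix.of fun i j => ((Nat.ofBits (u (i, j)) : ℕ) : ZMod q))

theorem adv_coinMatrix_bind_le {a b q κ : ℕ} [NeZero q] (hq : 2 ≤ q) (s : Set β)
    (F : Matrix (Fin a) (Fin b) (ZMod q) → PMF β) :
    adv s ((coinMatrix a b q κ).bind F) ((uniformMatrix a b q).bind F) ≤
      Fintype.card (MatBits a b q) * (2 ^ κ)⁻¹ := by
  have entry : (q : ℝ) / 2 ^ (Nat.clog 2 q + κ) ≤ (2 ^ κ)⁻¹ := by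
    have : (q : ℝ) ≤ 2 ^ Nat.clog 2 q := by exact_mod_cast Nat.le_pow_clog one_lt_two q
    rw [pow_add, div_le_iff₀ (by positivity)]
    field_simp
    exact this
  have card_le : Fintype.card (Fin a × Fin b) ≤ Fintype.card (MatBits a b q) := by
    simp only [Fintype.card_prod, Fintype.card_fin, ← mul_assoc]
    exact Nat.le_mul_of_pos_right _ (Nat.clog_pos one_lt_two hq)
  rw [uniformMatrix_bind_entries, coinMatrix_bind_entries]
  refine (adv_iid_bind_le_tvDist (ι := Fin a × Fin b) s _ _ fun u =>
    F (Matrix.of (Function.curry u))).trans ?_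
  refine (mul_le_mul_of_nonneg_left ((tvDist_map_ofBits_uniform_le q _).trans entry)
    (Nat.cast_nonneg _)).trans ?_
  gcongr

theorem adv_coinMatrix_bind_bind_le {a b q κ : ℕ} [NeZero q] (hq : 2 ≤ q) {s : Set β}
    {F G : Matrix (Fin a) (Fin b) (ZMod q) → PMF β} {ε : ℝ} (h : ∀ M, adv s (F M) (G M) ≤ ε) :
    adv s ((coinMatrix a b q κ).bind F) ((uniformMatrix a b q).bind G) ≤
      Fintype.card (MatBits a b q) * (2 ^ κ)⁻¹ + ε :=
  (adv_triangle s _ _ _).trans (add_le_add (adv_coinMatrix_bind_le hq s F) (adv_bind_le _ h))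

theorem uniform_sum_bind {ι κ : Type*} [Fintype ι] [DecidableEq ι] [Fintype κ] [DecidableEq κ]
    (f : (ι ⊕ κ → Bool) → PMF β) :
    (PMF.uniformOfFintype (ι ⊕ κ → Bool)).bind f =
      (PMF.uniformOfFintype (ι → Bool)).bind fun x => (PMF.uniformOfFintype (κ → Bool)).bind
        fun y => f (Sum.elim x y) := by
  rw [← uniform_bind_equiv (Equiv.sumArrowEquivProdArrow ι κ Bool).symm f, ← prodPMF_uniform,
    prodPMF_bind]
  rfl

end Sampling

/-! ### The simulator -/

/-- The coins of the simulator. -/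
abbrev SimCoins (p : Params) (κ : ℕ) : Type :=
  MatCoins p.n p.d₂ p.q κ ⊕ MatCoins p.n p.t p.q κ ⊕ MatCoins p.d₂ p.d₁ p.q κ ⊕
    MatCoins p.t p.d₁ p.q κ ⊕ MatCoins p.n p.d₁ p.q κ ⊕ MatCoins p.d₂ p.d₃ p.q κ ⊕
    MatCoins p.t p.d₃ 3 κ ⊕ MatCoins p.n p.d₃ p.q κ

instance (p : Params) (κ : ℕ) : DecidableEq (SimCoins p κ) := by
  unfold SimCoins MatCoins
  infer_instance

/-- The simulated view: each entry is the residue of the number whose binary digits are the coins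
for the entry. -/
def simulatedView {p : Params} {κ : ℕ} (x : SimCoins p κ → Bool) : View p where
  A := decMat _ fun z => x (.inl z)
  B := decMat _ fun z => x (.inr (.inl z))
  C := decMat _ fun z => x (.inr (.inr (.inl z)))
  C' := decMat _ fun z => x (.inr (.inr (.inr (.inl z))))
  S := decMat _ fun z => x (.inr (.inr (.inr (.inr (.inl z)))))
  Y := decMat _ fun z => x (.inr (.inr (.inr (.inr (.inr (.inl z))))))
  R := decMat _ fun z => x (.inr (.inr (.inr (.inr (.inr (.inr (.inl z)))))))
  H := decMat _ fun z => x (.inr (.inr (.inr (.inr (.inr (.inr (.inr z)))))))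

theorem affineView_simulatedView (p : Params) (κ : ℕ) {ι : Type} [Fintype ι]
    (e : SimCoins p κ → ι) : AffineView fun x : ι → Bool => simulatedView (p := p) (x ∘ e) := by
  constructor <;> exact fun i j => IsAffine.ofBits _

theorem map_simulatedView_eq (p : Params) (κ : ℕ) :
    ((PMF.uniformOfFintype (SimCoins p κ → Bool)).map fun x => (simulatedView x).encode) =
      (coinMatrix p.n p.d₂ p.q κ).bind fun A => (coinMatrix p.n p.t p.q κ).bind fun B =>
      (coinMatrix p.d₂ p.d₁ p.q κ).bind fun C => (coinMatrix p.t p.d₁ p.q κ).bind fun C' =>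
      (coinMatrix p.n p.d₁ p.q κ).bind fun S => (coinMatrix p.d₂ p.d₃ p.q κ).bind fun Y =>
      (coinMatrix p.t p.d₃ 3 κ).bind fun R => (coinMatrix p.n p.d₃ p.q κ).bind fun H =>
        PMF.pure (View.encode { A, B, C, C', S, Y, R, H : View p }) := by
  rw [← PMF.bind_pure_comp]
  simp only [uniform_sum_bind, coinMatrix, PMF.bind_map]
  rfl

theorem adv_simulatedView_uniformView_le (p : Params) (κ : ℕ) (s : Set (ViewBits p → Bool)) :
    adv s ((PMF.uniformOfFintype (SimCoins p κ → Bool)).map fun x => (simulatedView x).encode)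
      (uniformView p) ≤ Fintype.card (ViewBits p) * (2 ^ κ)⁻¹ := by
  have two_le_three : 2 ≤ 3 := by norm_num
  have hq := p.two_le_q
  rw [map_simulatedView_eq, uniformView]
  simp only [Fintype.card_sum, Nat.cast_add, add_mul]
  exact adv_coinMatrix_bind_bind_le hq fun A => adv_coinMatrix_bind_bind_le hq fun B =>
    adv_coinMatrix_bind_bind_le hq fun C => adv_coinMatrix_bind_bind_le hq fun C' =>
    adv_coinMatrix_bind_bind_le hq fun S => adv_coinMatrix_bind_bind_le hq fun Y =>
    adv_coinMatrix_bind_bind_le two_le_three fun R => adv_coinMatrix_bind_le hq s _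

theorem exists_simulator (p : Params) (κ : ℕ) :
    ∃ (c : ℕ) (G : Circuit (Fin c) (ViewBits p)),
      G.size ≤ Fintype.card (ViewBits p) *
        (Fintype.card (SimCoins p κ) * (modCost p.q + modCost 3)) + Fintype.card (ViewBits p) ∧
      ∀ s, adv s (samplerDist G) (uniformView p) ≤ Fintype.card (ViewBits p) * (2 ^ κ)⁻¹ := by
  let e := Fintype.equivFin (SimCoins p κ)
  obtain ⟨G, size_le, eval_eq⟩ :=
    (affineView_simulatedView p κ e).buildable_encode.exists_circuit
  have samplerDist_eq : samplerDist G =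
      (PMF.uniformOfFintype (SimCoins p κ → Bool)).map fun x => (simulatedView x).encode := by
    rw [samplerDist, eval_eq, ← PMF.bind_pure_comp, ← PMF.bind_pure_comp]
    exact uniform_bind_equiv (e.symm.arrowCongr (Equiv.refl Bool)) fun x =>
      PMF.pure (simulatedView x).encode
  rw [Fintype.card_fin] at size_le
  refine ⟨_, G, Nat.add_le_add_right size_le _, fun s => ?_⟩
  rw [samplerDist_eq]
  exact adv_simulatedView_uniformView_le p κ s

/-! ### Discrete Gaussians modulo `q` -/

section Gaussian

variable {σ : ℝ} {β : Type*}

theorem tsum_gauss_int_ne_top (hσ : 0 < σ) :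
    ∑' z : ℤ, ENNReal.ofReal (Real.exp (-Real.pi * (z : ℝ) ^ 2 / σ ^ 2)) ≠ ⊤ := by
  rw [← ENNReal.ofReal_tsum_of_nonneg (fun _ => (Real.exp_pos _).le) (summable_gauss_int hσ)]
  exact ENNReal.ofReal_ne_top

theorem tsum_gauss_int_ne_zero (σ : ℝ) :
    ∑' z : ℤ, ENNReal.ofReal (Real.exp (-Real.pi * (z : ℝ) ^ 2 / σ ^ 2)) ≠ 0 := fun h =>
  (ENNReal.ofReal_pos.2 (Real.exp_pos _)).ne' (ENNReal.tsum_eq_zero.1 h 0)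

/-- The discrete Gaussian distribution of width `σ` over `ℤ`. -/
def gaussInt (σ : ℝ) (hσ : 0 < σ) : PMF ℤ :=
  PMF.normalize (fun z => ENNReal.ofReal (Real.exp (-Real.pi * (z : ℝ) ^ 2 / σ ^ 2)))
    (tsum_gauss_int_ne_zero σ) (tsum_gauss_int_ne_top hσ)

/-- The discrete Gaussian distribution over `ℤ`, reduced modulo `q`. -/
def gaussMod (q : ℕ) (σ : ℝ) (hσ : 0 < σ) : PMF (ZMod q) :=
  (gaussInt σ hσ).map fun z : ℤ => (z : ZMod q)

theorem discreteGaussian_toMeasure (ι : Type) [Fintype ι] (hσ : 0 < σ) :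
    (discreteGaussian ι σ hσ).toMeasure =
      MeasureTheory.Measure.pi fun _ : ι => (gaussInt σ hσ).toMeasure := by
  set ν := MeasureTheory.Measure.pi fun _ : ι => (gaussInt σ hσ).toMeasure with hν
  set c := ∑' z : ℤ, ENNReal.ofReal (Real.exp (-Real.pi * (z : ℝ) ^ 2 / σ ^ 2))
  set w := ∑' x : ι → ℤ, ENNReal.ofReal (gaussWeight σ x) with hw
  have singleton_eq (x : ι → ℤ) :
      ν {x} = ENNReal.ofReal (gaussWeight σ x) * (c⁻¹) ^ Fintype.card ι := by
    rw [hν, MeasureTheory.Measure.pi_singleton, gaussWeight_eq_prod,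
      ENNReal.ofReal_prod_of_nonneg fun _ _ => (Real.exp_pos _).le]
    simp only [PMF.toMeasure_apply_singleton, measurableSet_singleton, gaussInt,
      PMF.normalize_apply]
    rw [Finset.prod_mul_distrib, Finset.prod_const, Finset.card_univ]
  have total : w * (c⁻¹) ^ Fintype.card ι = 1 := by
    rw [hw, ← ENNReal.tsum_mul_right, ← MeasureTheory.measure_univ (μ := ν),
      ← MeasureTheory.Measure.tsum_indicator_apply_singleton ν Set.univ MeasurableSet.univ]
    simp [singleton_eq]
  refine MeasureTheory.Measure.ext_of_singleton fun x => ?_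
  rw [singleton_eq, PMF.toMeasure_apply_singleton _ _ (measurableSet_singleton _),
    discreteGaussian, PMF.normalize_apply, ← hw, ENNReal.eq_inv_of_mul_eq_one_left total, inv_inv]

variable {q : ℕ} [NeZero q]

theorem discreteGaussian_map_cast (ι : Type) [Fintype ι] [DecidableEq ι] (hσ : 0 < σ) :
    (discreteGaussian ι σ hσ).map (fun x i => (x i : ZMod q)) = iid ι (gaussMod q σ hσ) := by
  ext y
  have preimage_eq : (fun (x : ι → ℤ) i => (x i : ZMod q)) ⁻¹' {y} =
      Set.univ.pi fun i => (fun z : ℤ => (z : ZMod q)) ⁻¹' {y i} := by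
    ext x
    simp [funext_iff]
  rw [← PMF.toOuterMeasure_apply_singleton, PMF.toOuterMeasure_map_apply, preimage_eq,
    ← PMF.toMeasure_apply_eq_toOuterMeasure, discreteGaussian_toMeasure,
    MeasureTheory.Measure.pi_pi, piPMF_apply]
  refine Finset.prod_congr rfl fun i _ => ?_
  rw [gaussMod, ← PMF.toOuterMeasure_apply_singleton _ (y i), PMF.toOuterMeasure_map_apply,
    PMF.toMeasure_apply_eq_toOuterMeasure]

theorem discreteGaussian_bind_cast {ι : Type} [Fintype ι] [DecidableEq ι] (hσ : 0 < σ)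
    (f : (ι → ZMod q) → PMF β) :
    ((discreteGaussian ι σ hσ).bind fun x => f fun i => (x i : ZMod q)) =
      (iid ι (gaussMod q σ hσ)).bind f := by
  rw [← discreteGaussian_map_cast, PMF.bind_map]
  rfl

theorem gaussMatrix_bind_cols {a b : ℕ} (hσ : 0 < σ)
    (f : Matrix (Fin a) (Fin b) (ZMod q) → PMF β) :
    (gaussMatrix a b q σ hσ).bind f =
      (iid (Fin b) (iid (Fin a) (gaussMod q σ hσ))).bind fun c => f (ofCols c) := by
  have map_iid : gaussMatrix a b q σ hσ =
      (iid (Fin a × Fin b) (gaussMod q σ hσ)).map fun x => Matrix.of fun i j => x (i, j) := by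
    rw [← discreteGaussian_map_cast, PMF.map_comp]
    rfl
  rw [map_iid, PMF.bind_map]
  refine bind_equiv (((Equiv.prodComm (Fin b) (Fin a)).arrowCongr (Equiv.refl _)).symm.trans
    (Equiv.curry (Fin b) (Fin a) (ZMod q))) (fun x => ?_) fun c => f (ofCols c)
  simp only [piPMF_apply]
  rw [Fintype.prod_prod_type, Finset.prod_comm]
  rfl

end Gaussian

/-! ### Independent blocks -/

section Blocks

variable {ι α β γ : Type*}

theorem iid_append_bind [Fintype ι] [DecidableEq ι] [Fintype α] {a b : ℕ} (μ : PMF α)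
    (f : (ι → Fin (a + b) → α) → PMF β) :
    (iid ι (iid (Fin (a + b)) μ)).bind f =
      (iid ι (iid (Fin a) μ)).bind fun x => (iid ι (iid (Fin b) μ)).bind fun y =>
        f fun j => Fin.append (x j) (y j) := by
  rw [← prodPMF_bind _ _ fun z : (ι → Fin a → α) × (ι → Fin b → α) =>
    f fun j => Fin.append (z.1 j) (z.2 j)]
  refine (bind_equiv ((Equiv.arrowProdEquivProdArrow ι _ _).symm.trans
    (Equiv.arrowCongr (Equiv.refl _) (Fin.appendEquiv a b))) ?_ f).symm
  rintro ⟨x, y⟩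
  rw [prodPMF_apply, piPMF_apply, piPMF_apply, piPMF_apply, ← Finset.prod_mul_distrib]
  refine Finset.prod_congr rfl fun j _ => ?_
  rw [piPMF_apply, piPMF_apply, piPMF_apply, Fin.prod_univ_add]
  simp [Fin.appendEquiv]

theorem iid_prod_bind [Fintype ι] [DecidableEq ι] [Fintype α] [Fintype β]
    (μ : PMF α) (ν : PMF β) (f : (ι → α × β) → PMF γ) :
    (iid ι (prodPMF μ ν)).bind f =
      (iid ι μ).bind fun x => (iid ι ν).bind fun y => f fun j => (x j, y j) := by
  rw [← prodPMF_bind _ _ fun z : (ι → α) × (ι → β) => f fun j => (z.1 j, z.2 j)]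
  refine (bind_equiv (Equiv.arrowProdEquivProdArrow ι _ _).symm ?_ f).symm
  rintro ⟨x, y⟩
  rw [prodPMF_apply, piPMF_apply, piPMF_apply, piPMF_apply, ← Finset.prod_mul_distrib]
  exact Finset.prod_congr rfl fun j _ => (prodPMF_apply μ ν (x j, y j)).symm

theorem uniformMatrix_append_bind {m a b q : ℕ} [NeZero q]
    (f : Matrix (Fin m) (Fin (a + b)) (ZMod q) → PMF β) :
    (uniformMatrix m (a + b) q).bind f =
      (uniformMatrix m a q).bind fun A => (uniformMatrix m b q).bind fun B =>
        f (Matrix.of fun i => Fin.append (A i) (B i)) := by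
  have rows {d : ℕ} (F : Matrix (Fin m) (Fin d) (ZMod q) → PMF β) : (uniformMatrix m d q).bind F =
      (iid (Fin m) (iid (Fin d) (PMF.uniformOfFintype (ZMod q)))).bind fun x =>
        F (Matrix.of x) := by
    rw [iid_uniform, iid_uniform]
    exact (uniform_bind_equiv (Matrix.of : (Fin m → Fin d → ZMod q) ≃ _) F).symm
  simp only [rows, iid_append_bind]
  rfl

end Blocks

/-! ### Reduction to LWE -/

section LWE

variable {n m q : ℕ}

/-- The seed `(s, e)` of an LWE sample: the secret and the error, modulo `q`. -/
abbrev LWESeed (n m q : ℕ) : Type := (Fin n → ZMod q) × (Fin m → ZMod q)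

/-- The LWE sample `Mᵀ s + e` computed from the seed `ξ = (s, e)`. -/
def lweSample (M : Matrix (Fin n) (Fin m) (ZMod q)) (ξ : LWESeed n m q) : Fin m → ZMod q :=
  Mᵀ *ᵥ ξ.1 + ξ.2

theorem lweSample_zero (M : Matrix (Fin n) (Fin m) (ZMod q)) (w : Fin m → ZMod q) :
    lweSample M (0, w) = w := by
  simp [lweSample]

theorem isAffine_lweSample {ι : Type} [Fintype ι]
    {M : (ι → Bool) → Matrix (Fin n) (Fin m) (ZMod q)} (hM : ∀ i k, IsAffine fun x => M x i k)
    (ξ : LWESeed n m q) (k : Fin m) : IsAffine fun x => lweSample (M x) ξ k :=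
  (IsAffine.sum Finset.univ fun i => (hM i k).mul_const (ξ.1 i)).add (.const (ξ.2 k))

/-- The seeds of genuine LWE samples. -/
def gaussSeed (n m q : ℕ) [NeZero q] (σ : ℝ) (hσ : 0 < σ) : PMF (LWESeed n m q) :=
  prodPMF (iid (Fin n) (gaussMod q σ hσ)) (iid (Fin m) (gaussMod q σ hσ))

/-- The seeds of uniform samples: the secret is zero and the error is uniform. -/
def uniformSeed (n m q : ℕ) [NeZero q] : PMF (LWESeed n m q) :=
  (uniformVec m q).map fun w => (0, w)

variable [NeZero q]

/-- The LWE distribution whose seeds are sampled from `π`, encoded. -/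
def lweDist (π : PMF (LWESeed n m q)) : PMF (LWEBits n m q → Bool) :=
  (uniformMatrix n m q).bind fun M => π.bind fun ξ =>
    PMF.pure (Sum.elim (encMat M) (encVec (lweSample M ξ)))

theorem lweReal_eq_lweDist (σ : ℝ) (hσ : 0 < σ) :
    lweReal n m q σ hσ = lweDist (gaussSeed n m q σ hσ) := by
  simp only [lweReal, lweDist, gaussSeed, bind, pure, prodPMF_bind, lweSample,
    ← discreteGaussian_bind_cast]

theorem lweUniform_eq_lweDist : lweUniform n m q = lweDist (uniformSeed n m q) := by
  simp only [lweUniform, lweDist, uniformSeed, PMF.bind_map, Function.comp_def,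
    lweSample_zero]
  rfl

/-- The part of a view that does not depend on the LWE samples: the shares of `S` and `Y`, the
coins of the party and the share of `H`. -/
abbrev Mask (p : Params) : Type :=
  Matrix (Fin p.n) (Fin p.d₁) (ZMod p.q) × Matrix (Fin p.d₂) (Fin p.d₃) (ZMod p.q) ×
    Matrix (Fin p.t) (Fin p.d₃) (ZMod 3) × Matrix (Fin p.n) (Fin p.d₃) (ZMod p.q)

theorem uniform_mask_bind {p : Params} {β : Type*} (f : Mask p → PMF β) :
    (PMF.uniformOfFintype (Mask p)).bind f =
      (uniformMatrix p.n p.d₁ p.q).bind fun U => (uniformMatrix p.d₂ p.d₃ p.q).bind fun V =>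
      (uniformMatrix p.t p.d₃ 3).bind fun R => (uniformMatrix p.n p.d₃ p.q).bind fun H =>
        f (U, V, R, H) := by
  simp only [← prodPMF_uniform, prodPMF_bind]
  rfl

/-- The view in which `(A | B) = M`, the ciphertexts `C - Xᵀ` and `C'` are the upper and the lower
part of the matrix with columns `c`, and the other messages are given by `u`. -/
def assemble {p : Params} (X : Matrix (Fin p.d₁) (Fin p.d₂) (ZMod p.q))
    (M : Matrix (Fin p.n) (Fin (p.d₂ + p.t)) (ZMod p.q))
    (c : Fin p.d₁ → Fin (p.d₂ + p.t) → ZMod p.q) (u : Mask p) : View p where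
  A := Matrix.of fun i k => M i (Fin.castAdd p.t k)
  B := Matrix.of fun i k => M i (Fin.natAdd p.d₂ k)
  C := Xᵀ + ofCols fun j k => c j (Fin.castAdd p.t k)
  C' := ofCols fun j k => c j (Fin.natAdd p.d₂ k)
  S := u.1
  Y := u.2.1
  R := u.2.2.1
  H := u.2.2.2

/-- The view in which the columns of the ciphertexts are LWE samples with seeds from `π`, and the
mask is uniform. -/
def lweView {p : Params} (X : Matrix (Fin p.d₁) (Fin p.d₂) (ZMod p.q))
    (π : PMF (LWESeed p.n (p.d₂ + p.t) p.q)) : PMF (ViewBits p → Bool) :=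
  (uniformMatrix p.n (p.d₂ + p.t) p.q).bind fun M => (iid (Fin p.d₁) π).bind fun ξ =>
  (PMF.uniformOfFintype (Mask p)).bind fun u =>
    PMF.pure (assemble X M (fun j => lweSample M (ξ j)) u).encode

/-- The view computed from an LWE instance, given by its bits `x`: the instance supplies `(A | B)`
and the ciphertext column `j`, and the other columns are computed with the seeds `ξ`. -/
def reducedView {p : Params} (X : Matrix (Fin p.d₁) (Fin p.d₂) (ZMod p.q))
    (ξ : Fin p.d₁ → LWESeed p.n (p.d₂ + p.t) p.q) (j : Fin p.d₁) (u : Mask p)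
    (x : LWEBits p.n (p.d₂ + p.t) p.q → Bool) : View p :=
  let M := decMat p.q fun z => x (.inl z)
  assemble X M
    (Function.update (fun i => lweSample M (ξ i)) j (decVec p.q fun z => x (.inr z))) u

theorem reducedView_encode_lweSample {p : Params} (X : Matrix (Fin p.d₁) (Fin p.d₂) (ZMod p.q))
    (ξ : Fin p.d₁ → LWESeed p.n (p.d₂ + p.t) p.q) (j : Fin p.d₁) (u : Mask p)
    (M : Matrix (Fin p.n) (Fin (p.d₂ + p.t)) (ZMod p.q)) (a : LWESeed p.n (p.d₂ + p.t) p.q) :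
    reducedView X ξ j u (Sum.elim (encMat M) (encVec (lweSample M a))) =
      assemble X M (fun i => lweSample M (Function.update ξ j a i)) u := by
  simp only [reducedView, Sum.elim_inl, Sum.elim_inr, decMat_encMat, decVec_encVec]
  exact congrArg (assemble X M · u) (Function.comp_update (lweSample M) ξ j a).symm

theorem affineView_reducedView {p : Params} (X : Matrix (Fin p.d₁) (Fin p.d₂) (ZMod p.q))
    (ξ : Fin p.d₁ → LWESeed p.n (p.d₂ + p.t) p.q) (j : Fin p.d₁) (u : Mask p) :
    AffineView (reducedView X ξ j u) := by
  have column (i : Fin p.d₁) (k : Fin (p.d₂ + p.t)) :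
      IsAffine fun x : LWEBits p.n (p.d₂ + p.t) p.q → Bool =>
        Function.update (fun i => lweSample (decMat p.q fun z => x (.inl z)) (ξ i)) j
          (decVec p.q fun z => x (.inr z)) i k := by
    rcases eq_or_ne i j with rfl | hij
    · simp only [Function.update_self]
      exact IsAffine.ofBits _
    · simp only [Function.update_of_ne hij]
      exact isAffine_lweSample (fun _ _ => IsAffine.ofBits _) (ξ i) k
  exact {
    A := fun _ _ => IsAffine.ofBits _
    B := fun _ _ => IsAffine.ofBits _
    C := fun k i => (IsAffine.const (X i k)).add (column i _)
    C' := fun _ i => column i _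
    S := fun _ _ => IsAffine.const _
    Y := fun _ _ => IsAffine.const _
    R := fun _ _ => IsAffine.const _
    H := fun _ _ => IsAffine.const _ }

theorem exists_adv_lweView_le {p : Params} (hd : p.d₁ ≠ 0)
    (X : Matrix (Fin p.d₁) (Fin p.d₂) (ZMod p.q)) (π₁ π₂ : PMF (LWESeed p.n (p.d₂ + p.t) p.q))
    (s : Set (ViewBits p → Bool)) :
    ∃ ξ j u, adv s (lweView X π₁) (lweView X π₂) ≤ p.d₁ *
      adv ((fun x => (reducedView X ξ j u x).encode) ⁻¹' s) (lweDist π₁) (lweDist π₂) := by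
  have : NeZero p.d₁ := ⟨hd⟩
  have lweView_eq (π : PMF (LWESeed p.n (p.d₂ + p.t) p.q)) :
      lweView X π = (PMF.uniformOfFintype (Mask p)).bind fun u => (iid (Fin p.d₁) π).bind fun ξ =>
        (uniformMatrix p.n (p.d₂ + p.t) p.q).bind fun M =>
          PMF.pure (assemble X M (fun j => lweSample M (ξ j)) u).encode := by
    simp only [lweView, PMF.bind_comm _ (PMF.uniformOfFintype (Mask p))]
    exact congrArg _ (funext fun u => PMF.bind_comm _ _ _)
  rw [lweView_eq, lweView_eq]
  obtain ⟨u, le_mask⟩ := exists_adv_bind_le s (PMF.uniformOfFintype (Mask p)) _ _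
  obtain ⟨j, ξ, le_column⟩ := exists_adv_iid_bind_le s π₁ π₂ fun ξ =>
    (uniformMatrix p.n (p.d₂ + p.t) p.q).bind fun M =>
      PMF.pure (assemble X M (fun j => lweSample M (ξ j)) u).encode
  refine ⟨ξ, j, u, (le_mask.trans le_column).trans_eq ?_⟩
  have map_lweDist (π : PMF (LWESeed p.n (p.d₂ + p.t) p.q)) :
      (lweDist π).map (fun x => (reducedView X ξ j u x).encode) = π.bind fun a =>
        (uniformMatrix p.n (p.d₂ + p.t) p.q).bind fun M => PMF.pure
          (assemble X M (fun i => lweSample M (Function.update ξ j a i)) u).encode := by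
    simp only [lweDist, PMF.map_bind, PMF.pure_map, reducedView_encode_lweSample]
    exact PMF.bind_comm _ _ _
  rw [Fintype.card_fin, ← map_lweDist, ← map_lweDist, adv, prob_map, prob_map, adv]

theorem exists_lwe_distinguisher {p : Params} (X : Matrix (Fin p.d₁) (Fin p.d₂) (ZMod p.q))
    (π₁ π₂ : PMF (LWESeed p.n (p.d₂ + p.t) p.q)) (D : Circuit (ViewBits p) Unit) :
    ∃ D' : Circuit (LWEBits p.n (p.d₂ + p.t) p.q) Unit,
      D'.size ≤ Fintype.card (ViewBits p) *
        (Fintype.card (LWEBits p.n (p.d₂ + p.t) p.q) * (modCost p.q + modCost 3)) + D.size ∧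
      |acceptProb D (lweView X π₁) - acceptProb D (lweView X π₂)| ≤
        p.d₁ * |acceptProb D' (lweDist π₁) - acceptProb D' (lweDist π₂)| := by
  rcases eq_or_ne p.d₁ 0 with hd | hd
  · have : IsEmpty (Fin p.d₁) := by rw [hd]; infer_instance
    have lweView_eq : lweView X π₁ = lweView X π₂ := by
      simp only [lweView, Subsingleton.elim _ (isEmptyElim : Fin p.d₁ → LWESeed _ _ _),
        PMF.bind_const]
    refine ⟨⟨[], fun _ => .const false⟩, ?_, ?_⟩
    · exact (Nat.add_le_add (Nat.zero_le _) le_rfl).trans (Nat.le_add_left _ _)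
    · rw [lweView_eq, sub_self, abs_zero]
      positivity
  · obtain ⟨ξ, j, u, le_lwe⟩ := exists_adv_lweView_le hd X π₁ π₂ {x | D.eval x () = true}
    obtain ⟨D', size_le, eval_eq⟩ :=
      (affineView_reducedView X ξ j u).buildable_encode.exists_comp_circuit D
    refine ⟨D', size_le, le_lwe.trans_eq ?_⟩
    simp only [adv, prob, acceptProb, eval_eq]
    rfl

end LWE

/-! ### The view of a party -/

section View

variable {p : Params}

/-- The view with genuine LWE ciphertexts `C`, `C'` and uniform shares of `S` and `Y`, in which the
other party's share of `H` is sampled from `h A B V`, where `V` is the party's share of `Y`. -/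
def gaussView (X : Matrix (Fin p.d₁) (Fin p.d₂) (ZMod p.q))
    (h : Matrix (Fin p.n) (Fin p.d₂) (ZMod p.q) → Matrix (Fin p.n) (Fin p.t) (ZMod p.q) →
      Matrix (Fin p.d₂) (Fin p.d₃) (ZMod p.q) → PMF (Matrix (Fin p.n) (Fin p.d₃) (ZMod p.q))) :
    PMF (ViewBits p → Bool) :=
  (uniformMatrix p.n p.d₂ p.q).bind fun A => (uniformMatrix p.n p.t p.q).bind fun B =>
  (gaussMatrix p.n p.d₁ p.q p.σ p.σ_pos).bind fun S =>
  (gaussMatrix p.d₂ p.d₁ p.q p.σ p.σ_pos).bind fun E =>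
  (gaussMatrix p.t p.d₁ p.q p.σ p.σ_pos).bind fun E' =>
  (uniformMatrix p.n p.d₁ p.q).bind fun U => (uniformMatrix p.d₂ p.d₃ p.q).bind fun V =>
  (uniformMatrix p.t p.d₃ 3).bind fun R => (h A B V).bind fun H =>
    PMF.pure (View.encode {
      A := A, B := B, C := Aᵀ * S + Xᵀ + E, C' := Bᵀ * S + E', S := U, Y := V, R := R, H := H })

/-- The distribution of the other party's share of `H`, when this party's share of `Y` is `V`. -/
def hashShare (Y : Matrix (Fin p.d₂) (Fin p.d₃) (ZMod p.q))
    (A : Matrix (Fin p.n) (Fin p.d₂) (ZMod p.q)) (B : Matrix (Fin p.n) (Fin p.t) (ZMod p.q))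
    (V : Matrix (Fin p.d₂) (Fin p.d₃) (ZMod p.q)) : PMF (Matrix (Fin p.n) (Fin p.d₃) (ZMod p.q)) :=
  (uniformMatrix p.t p.d₃ 3).map fun R => A * (Y - V) + B * ternary p.q R

-- A share `M - U` is as uniform as the share `U`, so the views of `P₀` and `P₁` have the same form.
theorem viewDist_eq_gaussView (i : Fin 2) (p : Params)
    (X : Matrix (Fin p.d₁) (Fin p.d₂) (fixedPoint p.k p.l))
    (Y : Matrix (Fin p.d₂) (Fin p.d₃) (fixedPoint p.k p.l)) :
    viewDist i p X Y =
      gaussView (encodeFixed p.l p.q X) (hashShare (encodeFixed p.l p.q Y)) := by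
  simp only [viewDist, mult, setup, offline, online, share, gaussView, hashShare, bind, pure,
    PMF.map_bind, PMF.bind_bind, PMF.pure_bind, PMF.pure_map, PMF.bind_map, Function.comp_def]
  refine pmf_bind_congr fun A => pmf_bind_congr fun B => pmf_bind_congr fun S =>
    pmf_bind_congr fun E => pmf_bind_congr fun E' => ?_
  fin_cases i
  · rfl
  · refine (uniform_bind_equiv (Equiv.subLeft S) _).symm.trans (pmf_bind_congr fun U => ?_)
    refine (uniform_bind_equiv (Equiv.subLeft (encodeFixed p.l p.q Y)) _).symm.trans
      (pmf_bind_congr fun V => ?_)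
    refine (PMF.bind_comm _ _ _).trans (pmf_bind_congr fun R => pmf_bind_congr fun R' => ?_)
    simp [Execution.view]

theorem assemble_append (X : Matrix (Fin p.d₁) (Fin p.d₂) (ZMod p.q))
    (A : Matrix (Fin p.n) (Fin p.d₂) (ZMod p.q)) (B : Matrix (Fin p.n) (Fin p.t) (ZMod p.q))
    (x : Fin p.d₁ → Fin p.d₂ → ZMod p.q) (y : Fin p.d₁ → Fin p.t → ZMod p.q) (u : Mask p) :
    assemble X (Matrix.of fun i => Fin.append (A i) (B i)) (fun j => Fin.append (x j) (y j)) u = {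
      A := A, B := B, C := Xᵀ + ofCols x, C' := ofCols y
      S := u.1, Y := u.2.1, R := u.2.2.1, H := u.2.2.2 } := by
  simp only [assemble, Matrix.of_apply, Fin.append_left, Fin.append_right]
  rfl

theorem lweSample_append {n a b q : ℕ} (A : Matrix (Fin n) (Fin a) (ZMod q))
    (B : Matrix (Fin n) (Fin b) (ZMod q)) (s : Fin n → ZMod q) (e : Fin a → ZMod q)
    (e' : Fin b → ZMod q) :
    lweSample (Matrix.of fun i => Fin.append (A i) (B i)) (s, Fin.append e e') =
      Fin.append (lweSample A (s, e)) (lweSample B (s, e')) := by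
  ext k
  refine Fin.addCases (fun k => ?_) (fun k => ?_) k <;>
    simp [lweSample, Matrix.mulVec, dotProduct]

theorem ofCols_lweSample {n m d q : ℕ} (M : Matrix (Fin n) (Fin m) (ZMod q))
    (s : Fin d → Fin n → ZMod q) (e : Fin d → Fin m → ZMod q) :
    (ofCols fun j => lweSample M (s j, e j)) = Mᵀ * ofCols s + ofCols e :=
  rfl

theorem gaussView_uniform (X : Matrix (Fin p.d₁) (Fin p.d₂) (ZMod p.q)) :
    gaussView X (fun _ _ _ => uniformMatrix p.n p.d₃ p.q) =
      lweView X (gaussSeed p.n (p.d₂ + p.t) p.q p.σ p.σ_pos) := by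
  simp only [gaussView, lweView, gaussSeed, uniformMatrix_append_bind, iid_prod_bind,
    iid_append_bind, gaussMatrix_bind_cols, uniform_mask_bind, lweSample_append,
    assemble_append]
  refine pmf_bind_congr fun A => pmf_bind_congr fun B => pmf_bind_congr fun S =>
    pmf_bind_congr fun E => pmf_bind_congr fun E' => pmf_bind_congr fun U =>
    pmf_bind_congr fun V => pmf_bind_congr fun R => pmf_bind_congr fun H =>
      congrArg PMF.pure (congrArg View.encode ?_)
  rw [ofCols_lweSample, ofCols_lweSample, add_left_comm, ← add_assoc]

theorem uniformView_eq_lweView (X : Matrix (Fin p.d₁) (Fin p.d₂) (ZMod p.q)) :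
    uniformView p = lweView X (uniformSeed p.n (p.d₂ + p.t) p.q) := by
  have iid_seed {β : Type} (f : (Fin p.d₁ → LWESeed p.n (p.d₂ + p.t) p.q) → PMF β) :
      (iid (Fin p.d₁) (uniformSeed p.n (p.d₂ + p.t) p.q)).bind f =
        (iid (Fin p.d₁) (iid (Fin (p.d₂ + p.t)) (PMF.uniformOfFintype (ZMod p.q)))).bind fun w =>
          f fun j => (0, w j) := by
    rw [uniformSeed, ← iid_map, PMF.bind_map, iid_uniform]
    rfl
  have shift_C (F : Matrix (Fin p.d₂) (Fin p.d₁) (ZMod p.q) → PMF (ViewBits p → Bool)) :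
      (uniformMatrix p.d₂ p.d₁ p.q).bind F =
        (iid (Fin p.d₁) (iid (Fin p.d₂) (PMF.uniformOfFintype (ZMod p.q)))).bind fun x =>
          F (Xᵀ + ofCols x) := by
    rw [iid_uniform, ← uniformVec, ← uniformMatrix_bind_cols fun C => F (Xᵀ + C)]
    exact (uniform_bind_equiv (Equiv.addLeft Xᵀ) F).symm
  simp only [uniformView, lweView, bind, pure, uniformMatrix_append_bind, iid_seed,
    iid_append_bind, uniform_mask_bind, shift_C]
  refine pmf_bind_congr fun A => pmf_bind_congr fun B => pmf_bind_congr fun x => ?_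
  rw [uniformMatrix_bind_cols, uniformVec, ← iid_uniform]
  refine pmf_bind_congr fun y => pmf_bind_congr fun U => pmf_bind_congr fun V =>
    pmf_bind_congr fun R => pmf_bind_congr fun H => congrArg PMF.pure (congrArg View.encode ?_)
  simp only [lweSample_zero, assemble_append]

theorem adv_hashShare_bind_le {β : Type*} (Y : Matrix (Fin p.d₂) (Fin p.d₃) (ZMod p.q))
    (A : Matrix (Fin p.n) (Fin p.d₂) (ZMod p.q)) (B : Matrix (Fin p.n) (Fin p.t) (ZMod p.q))
    (V : Matrix (Fin p.d₂) (Fin p.d₃) (ZMod p.q)) (s : Set β)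
    (F : Matrix (Fin p.n) (Fin p.d₃) (ZMod p.q) → PMF β) :
    adv s ((hashShare Y A B V).bind F) ((uniformMatrix p.n p.d₃ p.q).bind F) ≤
      p.d₃ * tvDist (ternaryHash B) (uniformVec p.n p.q) := by
  have shift : ((uniformMatrix p.n p.d₃ p.q).bind fun W => F (A * (Y - V) + W)) =
      (uniformMatrix p.n p.d₃ p.q).bind F := uniform_bind_equiv (Equiv.addLeft (A * (Y - V))) F
  rw [hashShare, PMF.bind_map, ← shift]
  exact adv_mul_ternary_le B s fun W => F (A * (Y - V) + W)

theorem adv_viewDist_lweView_le {β : ℝ} (hβ : 1 ≤ β)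
    (ht : 2 * (p.n : ℝ) * Real.logb 2 p.q ≤ p.t) (i : Fin 2)
    (X : Matrix (Fin p.d₁) (Fin p.d₂) (fixedPoint p.k p.l))
    (Y : Matrix (Fin p.d₂) (Fin p.d₃) (fixedPoint p.k p.l)) (s : Set (ViewBits p → Bool)) :
    adv s (viewDist i p X Y)
        (lweView (encodeFixed p.l p.q X) (gaussSeed p.n (p.d₂ + p.t) p.q p.σ p.σ_pos)) ≤
      p.d₃ * √√(sisSuccess β (basisCircuit (SISBits p.n p.t p.q) p.t)) := by
  rw [viewDist_eq_gaussView, ← gaussView_uniform, gaussView, gaussView, PMF.bind_comm,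
    PMF.bind_comm (uniformMatrix p.n p.d₂ p.q)]
  refine adv_uniformMatrix_bind_le_sisSuccess p.two_le_q ht hβ p.d₃ fun B => ?_
  refine adv_bind_le _ fun A => adv_bind_le _ fun S => adv_bind_le _ fun E =>
    adv_bind_le _ fun E' => adv_bind_le _ fun U => adv_bind_le _ fun V => adv_bind_le _ fun R => ?_
  exact adv_hashShare_bind_le _ A B V s _

end View

/-! ### Computational indistinguishability of the views -/

section Asymptotic

theorem CompIndist.of_adv_le {ι : ℕ → Type} {P Q : ∀ κ, PMF (ι κ → Bool)} {ε : ℕ → ℝ}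
    (hε : Negligible ε) (h : ∀ κ s, adv s (P κ) (Q κ) ≤ ε κ) : CompIndist P Q := fun D _ =>
  hε.mono fun κ => (abs_abs _).trans_le (h κ {x | (D κ).eval x () = true})

theorem polyBounded_modCost {q : ℕ → ℕ} (hq : PolyBounded fun κ => Nat.clog 2 (q κ)) :
    PolyBounded fun κ => modCost (q κ) :=
  hq.mul (((PolyBounded.const 18).mul hq).add (.const 22))

variable {p : ℕ → Params} (hp : PolyParams p)

include hp

theorem polyBounded_card_viewBits : PolyBounded fun κ => Fintype.card (ViewBits (p κ)) := by
  simp only [Fintype.card_sum, Fintype.card_prod, Fintype.card_fin]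
  exact (hp.n.mul (hp.d₂.mul hp.log_q)).add <| (hp.n.mul (hp.t.mul hp.log_q)).add <|
    (hp.d₂.mul (hp.d₁.mul hp.log_q)).add <| (hp.t.mul (hp.d₁.mul hp.log_q)).add <|
    (hp.n.mul (hp.d₁.mul hp.log_q)).add <| (hp.d₂.mul (hp.d₃.mul hp.log_q)).add <|
    (hp.t.mul (hp.d₃.mul (.const _))).add (hp.n.mul (hp.d₃.mul hp.log_q))

theorem polyBounded_card_simCoins : PolyBounded fun κ => Fintype.card (SimCoins (p κ) κ) := by
  have coins : PolyBounded fun κ => Nat.clog 2 (p κ).q + κ := hp.log_q.add .id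
  have ternaryCoins : PolyBounded fun κ => Nat.clog 2 3 + κ := (PolyBounded.const _).add .id
  simp only [Fintype.card_sum, Fintype.card_prod, Fintype.card_fin]
  exact (hp.n.mul (hp.d₂.mul coins)).add <| (hp.n.mul (hp.t.mul coins)).add <|
    (hp.d₂.mul (hp.d₁.mul coins)).add <| (hp.t.mul (hp.d₁.mul coins)).add <|
    (hp.n.mul (hp.d₁.mul coins)).add <| (hp.d₂.mul (hp.d₃.mul coins)).add <|
    (hp.t.mul (hp.d₃.mul ternaryCoins)).add (hp.n.mul (hp.d₃.mul coins))

theorem polyBounded_card_lweBits :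
    PolyBounded fun κ => Fintype.card (LWEBits (p κ).n ((p κ).d₂ + (p κ).t) (p κ).q) := by
  simp only [Fintype.card_sum, Fintype.card_prod, Fintype.card_fin]
  have samples := hp.d₂.add hp.t
  exact (hp.n.mul (samples.mul hp.log_q)).add (samples.mul hp.log_q)

theorem polyBounded_viewBits_mul_modCost {c : ℕ → ℕ} (hc : PolyBounded c) :
    PolyBounded fun κ => Fintype.card (ViewBits (p κ)) * (c κ * (modCost (p κ).q + modCost 3)) :=
  (polyBounded_card_viewBits hp).mul (hc.mul ((polyBounded_modCost hp.log_q).add (.const _)))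

theorem SISAssumption.compIndist_viewDist_lweView {β : ℕ → ℝ} (hSIS : SISAssumption p β)
    (hβ : ∀ κ, 1 ≤ β κ) (ht : ∀ κ, 2 * ((p κ).n : ℝ) * Real.logb 2 (p κ).q ≤ (p κ).t) (i : Fin 2)
    (X : ∀ κ, Matrix (Fin (p κ).d₁) (Fin (p κ).d₂) (fixedPoint (p κ).k (p κ).l))
    (Y : ∀ κ, Matrix (Fin (p κ).d₂) (Fin (p κ).d₃) (fixedPoint (p κ).k (p κ).l)) :
    CompIndist (fun κ => viewDist i (p κ) (X κ) (Y κ)) fun κ =>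
      lweView (encodeFixed (p κ).l (p κ).q (X κ)) (gaussSeed _ _ _ (p κ).σ (p κ).σ_pos) := by
  have size_eq (κ : ℕ) : (basisCircuit (SISBits (p κ).n (p κ).t (p κ).q) (p κ).t).size =
      (p κ).t * 2 := by
    simp [Circuit.size, basisCircuit]
  have negligible_sis := hSIS (fun _ => 1) (fun κ => basisCircuit _ (p κ).t)
    ((hp.t.mul (.const 2)).mono fun κ => (size_eq κ).le)
  exact .of_adv_le (negligible_sis.sqrt.sqrt.polyBounded_mul hp.d₃) fun κ =>
    adv_viewDist_lweView_le (hβ κ) (ht κ) i (X κ) (Y κ)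

theorem LWEAssumption.compIndist_lweView_uniformView
    (hLWE : LWEAssumption p fun κ => (p κ).d₂ + (p κ).t)
    (X : ∀ κ, Matrix (Fin (p κ).d₁) (Fin (p κ).d₂) (ZMod (p κ).q)) :
    CompIndist (fun κ => lweView (X κ) (gaussSeed _ _ _ (p κ).σ (p κ).σ_pos)) fun κ =>
      uniformView (p κ) := by
  rw [funext fun κ => uniformView_eq_lweView (X κ)]
  intro D hD
  choose D' size_le le_lwe using fun κ => exists_lwe_distinguisher (X κ)
    (gaussSeed _ _ _ (p κ).σ (p κ).σ_pos) (uniformSeed _ _ _) (D κ)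
  have negligible_lwe := hLWE D' <|
    ((polyBounded_viewBits_mul_modCost hp (polyBounded_card_lweBits hp)).add hD).mono size_le
  simp only [lweReal_eq_lweDist, lweUniform_eq_lweDist] at negligible_lwe
  refine (negligible_lwe.polyBounded_mul hp.d₁).mono fun κ => ?_
  rw [abs_abs]
  exact le_lwe κ

theorem exists_polyBounded_simulator :
    ∃ (c : ℕ → ℕ) (Sim : ∀ κ, Circuit (Fin (c κ)) (ViewBits (p κ))),
      PolyBounded (fun κ => (Sim κ).size) ∧
      CompIndist (fun κ => uniformView (p κ)) fun κ => samplerDist (Sim κ) := by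
  choose c Sim size_le adv_le using fun κ => exists_simulator (p κ) κ
  refine ⟨c, Sim, ?_, ?_⟩
  · exact ((polyBounded_viewBits_mul_modCost hp (polyBounded_card_simCoins hp)).add
      (polyBounded_card_viewBits hp)).mono size_le
  · refine .of_adv_le (negligible_inv_two_pow.polyBounded_mul (polyBounded_card_viewBits hp))
      fun κ s => ?_
    rw [adv_comm]
    exact adv_le κ s

end Asymptotic

end SecureMult

end

open SecureMult in
theorem mainTheorem3 (p : ℕ → Params) (hp : PolyParams p)
    (ht : ∀ κ, 2 * ((p κ).n : ℝ) * Real.logb 2 (p κ).q ≤ (p κ).t)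
    (β : ℕ → ℝ) (hβ : ∀ κ, 2 ≤ β κ)
    (hLWE : LWEAssumption p fun κ => (p κ).d₂ + (p κ).t)
    (hSIS : SISAssumption p β) (i : Fin 2) :
    ∃ (c : ℕ → ℕ) (Sim : ∀ κ, Circuit (Fin (c κ)) (ViewBits (p κ))),
      PolyBounded (fun κ => (Sim κ).size) ∧
      ∀ (X : ∀ κ, Matrix (Fin (p κ).d₁) (Fin (p κ).d₂) (fixedPoint (p κ).k (p κ).l))
        (Y : ∀ κ, Matrix (Fin (p κ).d₂) (Fin (p κ).d₃) (fixedPoint (p κ).k (p κ).l)),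
        CompIndist (fun κ => viewDist i (p κ) (X κ) (Y κ)) (fun κ => samplerDist (Sim κ)) ∧
        CompIndist (fun κ => viewDist i (p κ) (X κ) (Y κ)) (fun κ => uniformView (p κ)) := by
  obtain ⟨c, Sim, size_poly, uniform_sim⟩ := exists_polyBounded_simulator hp
  refine ⟨c, Sim, size_poly, fun X Y => ?_⟩
  have view_uniform : CompIndist (fun κ => viewDist i (p κ) (X κ) (Y κ))
      fun κ => uniformView (p κ) :=
    (hSIS.compIndist_viewDist_lweView hp (fun κ => one_le_two.trans (hβ κ)) ht i X Y).trans
      (hLWE.compIndist_lweView_uniformView hp _)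
  exact ⟨view_uniform.trans uniform_sim, view_uniform⟩
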